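/- An *ordered graph* is a finite simple graph whose vertex set carries a total order; ordered graphs are considered up to order-preserving isomorphism. A class $\mathscr C$ of ordered graphs is *hereditary* if it is closed under induced ordered subgraphs, and its *growth* is the function sending $n$ to the number $|\mathscr C_n|$ of $n$-vertex ordered graphs in $\mathscr C$, up to isomorphism. The growth is $2^{O(n)}$ if there is $K$ with $|\mathscr C_n|\le 2^{Kn}$ for all large $n$, and it is $2^{\omega(n)}$ if for every $K$ we have $|\mathscr C_n|\ge 2^{Kn}$ for all large $n$. For a permutation $\pi$ of $[n]=\{1,\dots,n\}$, the *ordered permutation graph* of $\pi$ has vertices $1<\dots<n$, with $i<j$ adjacent if and only if $\pi(i)>\pi(j)$. Let $\mathscr P$ be the class of all ordered permutation graphs. For $s\in\{=,\neq,\le_l,\ge_l,\le_r,\ge_r\}$, $\lambda,\rho\in\{0,1\}$ and a permutation $\sigma$ of $[n]$, let $G_{s,\lambda,\rho}(\sigma)$ be the ordered graph with vertices $a_1<\dots<a_n<b_1<\dots<b_n$ in which the $a_i$ form a clique if $\lambda=1$ and an independent set if $\lambda=0$, the $b_j$ form a clique if $\rho=1$ and an independent set if $\rho=0$, and $a_i$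 is adjacent to $b_j$ if and only if, respectively, $\sigma(i)=j$, $\ \sigma(i)\ne j$, $\ i\le\sigma^{-1}(j)$, $\ i\ge\sigma^{-1}(j)$, $\ j\le\sigma(i)$, $\ j\ge\sigma(i)$. Let $\mathscr M_{s,\lambda,\rho}$ be the class of all induced ordered subgraphs of the graphs $G_{s,\lambda,\rho}(\sigma)$, over all $n$ and all permutations $\sigma$ of $[n]$. **Corollary.** A class $\mathscr C$ of ordered graphs is hereditary, has growth $2^{\omega(n)}$, and has the property that every proper hereditary subclass of $\mathscr C$ has growth $2^{O(n)}$, if and only if $\mathscr C$ is one of the classes $\mathscr P$ and $\mathscr M_{s,\lambda,\rho}$ with $s\in\{=,\neq,\le_l,\ge_l,\le_r,\ge_r\}$ and $\lambda,\rho\in\{0,1\}$. Moreover, none of these classes, indexed by $\mathscr P$ and the 24 triples $(s,\lambda,\rho)$, is included in another one; in particular they are exactly 25 distinct classes. -/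

import Mathlib

/-- A class of finite ordered graphs. A finite linear order with `n` elements is isomorphic to
`Fin n` by a unique order isomorphism, so isomorphism types of ordered graphs on `n` vertices are
the same thing as graphs on `Fin n`. A class of ordered graphs (closed under isomorphism) is thus
given by, for every `n`, its set of graphs with vertex set `Fin n`. Inclusion of classes is the
pointwise order `≤`, and `D < C` means that `D` is a proper subclass of `C`. -/
abbrev OrderedGraphClass : Type := (n : ℕ) → Set (SimpleGraph (Fin n))

namespace OrderedGraphClass

/-- Closed under induced ordered subgraphs: an induced ordered subgraph on `m` vertices of a graph
on `Fin n` is, up to isomorphism, the pullback along an order embedding `Fin m ↪o Fin n`. -/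
def IsHereditary (C : OrderedGraphClass) : Prop :=
  ∀ ⦃m n : ℕ⦄ (f : Fin m ↪o Fin n) (G : SimpleGraph (Fin n)), G ∈ C n → G.comap f ∈ C m

/-- The number of `n`-vertex ordered graphs in the class, up to isomorphism. -/
noncomputable def growth (C : OrderedGraphClass) (n : ℕ) : ℕ := (C n).ncard

/-- Growth `2 ^ O(n)`. -/
def HasExpGrowth (C : OrderedGraphClass) : Prop :=
  ∃ K : ℕ, ∀ᶠ n in Filter.atTop, C.growth n ≤ 2 ^ (K * n)

/-- Growth `2 ^ ω(n)`. -/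
def HasSuperexpGrowth (C : OrderedGraphClass) : Prop :=
  ∀ K : ℕ, ∀ᶠ n in Filter.atTop, 2 ^ (K * n) ≤ C.growth n

/-- Hereditary classes with growth `2 ^ ω(n)` all of whose proper hereditary subclasses have
growth `2 ^ O(n)`. -/
def IsStanleyWilf (C : OrderedGraphClass) : Prop :=
  C.IsHereditary ∧ C.HasSuperexpGrowth ∧
    ∀ D : OrderedGraphClass, D.IsHereditary → D < C → D.HasExpGrowth

/-- The ordered permutation graph of `π`: vertices `i < j` are adjacent iff `π j < π i`. -/
def permGraph {n : ℕ} (π : Equiv.Perm (Fin n)) : SimpleGraph (Fin n) where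
  Adj i j := (i < j ∧ π j < π i) ∨ (j < i ∧ π i < π j)
  symm := ⟨fun _ _ h => h.symm⟩
  loopless := ⟨fun i h => by simp at h⟩

/-- The class of all ordered permutation graphs. -/
def permClass : OrderedGraphClass := fun _ => Set.range permGraph

/-- The six parameters `=`, `≠`, `≤_l`, `≥_l`, `≤_r`, `≥_r`. -/
inductive Pattern : Type
  | eq | ne | leL | geL | leR | geR

/-- Adjacency between the `i`-th left vertex and the `j`-th right vertex in the ordered graph with
parameter `s` obtained from the ordered matching in which `i` is matched with `σ i`. -/
def Pattern.cross {n : ℕ} (s : Pattern) (σ : Equiv.Perm (Fin n)) (i j : Fin n) : Prop :=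
  match s with
  | .eq => σ i = j
  | .ne => σ i ≠ j
  | .leL => i ≤ σ.symm j
  | .geL => i ≥ σ.symm j
  | .leR => j ≤ σ i
  | .geR => j ≥ σ i

/-- The adjacency relation of the ordered graph below. -/
def matchingAdj {n : ℕ} (s : Pattern) (lam rho : Bool) (σ : Equiv.Perm (Fin n)) :
    Fin n ⊕ Fin n → Fin n ⊕ Fin n → Prop
  | .inl i, .inl j => i ≠ j ∧ lam = true
  | .inr i, .inr j => i ≠ j ∧ rho = true
  | .inl i, .inr j => s.cross σ i j
  | .inr j, .inl i => s.cross σ i j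

/-- The ordered graph with left vertices `a₁ < ... < aₙ` (the left summand), followed by right
vertices `b₁ < ... < bₙ` (the right summand; `⊕ₗ` is the lexicographically ordered sum), in which
the left vertices form a clique if `lam` and an independent set otherwise, the right vertices form
a clique if `rho` and an independent set otherwise, and the edges between left and right vertices
are given by `s` and `σ`. -/
def matchingGraph {n : ℕ} (s : Pattern) (lam rho : Bool) (σ : Equiv.Perm (Fin n)) :
    SimpleGraph (Fin n ⊕ₗ Fin n) where
  Adj u v := matchingAdj s lam rho σ (ofLex u) (ofLex v)
  symm := ⟨fun u v h => by
    rcases hu : ofLex u with i | i <;> rcases hv : ofLex v with j | j <;>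
      simp_all [matchingAdj, eq_comm]⟩
  loopless := ⟨fun u h => by
    rcases hu : ofLex u with i | i <;> simp_all [matchingAdj]⟩

/-- The hereditary closure of the class of all ordered graphs `matchingGraph s lam rho σ`. -/
def matchingClass (s : Pattern) (lam rho : Bool) : OrderedGraphClass := fun m =>
  {H | ∃ (n : ℕ) (σ : Equiv.Perm (Fin n)) (f : Fin m ↪o Fin n ⊕ₗ Fin n),
    H = (matchingGraph s lam rho σ).comap f}

end OrderedGraphClass

/-!
Cut the vertices of an ordered graph into short intervals. If the adjacency matrix contains no large
grid of pairs of rows, each pair lying in one interval and distinguished by a column (a *universal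
grid*), then by the Marcus–Tardos theorem a positive fraction of the intervals contain two vertices
whose rows agree outside boundedly many columns. One vertex of each of these pairs can be deleted,
the graph being recovered from the positions where the two rows differ; these positions are again
free of large grids, so by Klazar's argument there are only `2 ^ O(n)` choices for them. Hence, by
induction, a hereditary class avoiding some universal grid has growth `2 ^ O(n)`.

In a large universal grid, Ramsey's theorem makes all adjacencies depend only on the relative order
of the coordinates, and then every permutation can be read off as a generator of one of the 25
classes. These have growth `2 ^ ω(n)`, since their generators encode all permutations, and none of
them contains another one, so they are the minimal hereditary classes of growth `2 ^ ω(n)`.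
-/

/-! ### Marcus–Tardos theorem -/

section MarcusTardos

open Finset

/-- A `k`-grid in a set of matrix positions: the rows and the columns can be divided into `k`
consecutive groups such that each of the `k ^ 2` cells contains a position of the set. The
division is encoded by a choice of a position `(I a b, J a b)` in every cell `(a, b)`. -/
def HasGrid (S : Set (ℕ × ℕ)) (k : ℕ) : Prop :=
  ∃ I J : Fin k → Fin k → ℕ, (∀ a b, (I a b, J a b) ∈ S) ∧
    (∀ a a' b b', a < a' → I a b < I a' b') ∧ (∀ a a' b b', b < b' → J a b < J a' b')

/-- Contraction of the `t × t` blocks of a matrix. -/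
def contract (t : ℕ) (p : ℕ × ℕ) : ℕ × ℕ := (p.1 / t, p.2 / t)

namespace HasGrid

variable {S T : Set (ℕ × ℕ)} {k t : ℕ}

theorem zero (S : Set (ℕ × ℕ)) : HasGrid S 0 :=
  ⟨fun a => a.elim0, fun a => a.elim0, fun a => a.elim0, fun a => a.elim0, fun _ _ b => b.elim0⟩

theorem mono (h : HasGrid S k) (hST : S ⊆ T) : HasGrid T k := by
  obtain ⟨I, J, hmem, hI, hJ⟩ := h
  exact ⟨I, J, fun a b => hST (hmem a b), hI, hJ⟩

theorem of_preimage_swap (h : HasGrid (Prod.swap ⁻¹' S) k) : HasGrid S k := by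
  obtain ⟨I, J, hmem, hI, hJ⟩ := h
  exact ⟨fun a b => J b a, fun a b => I b a, fun a b => hmem b a,
    fun a a' b b' => hJ b b' a a', fun a a' b b' => hI b b' a a'⟩

theorem of_image_swap (h : HasGrid (Prod.swap '' S) k) : HasGrid S k :=
  of_preimage_swap (by rwa [← Set.image_swap_eq_preimage_swap])

theorem of_image_contract (h : HasGrid (contract t '' S) k) : HasGrid S k := by
  obtain ⟨I, J, hmem, hI, hJ⟩ := h
  choose f hf hfIJ using hmem
  have hfI (a b) : (f a b).1 / t = I a b := congrArg Prod.fst (hfIJ a b)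
  have hfJ (a b) : (f a b).2 / t = J a b := congrArg Prod.snd (hfIJ a b)
  refine ⟨fun a b => (f a b).1, fun a b => (f a b).2, hf, fun a a' b b' h => ?_,
    fun a a' b b' h => ?_⟩
  · exact Nat.lt_of_div_lt_div (c := t) (by simpa only [hfI] using hI _ _ _ _ h)
  · exact Nat.lt_of_div_lt_div (c := t) (by simpa only [hfJ] using hJ _ _ _ _ h)

end HasGrid

/-- The columns of `S` occurring in the block `b` of size `t × t`. -/
def blockCols (S : Finset (ℕ × ℕ)) (t : ℕ) (b : ℕ × ℕ) : Finset ℕ :=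
  {p ∈ S | contract t p = b}.image Prod.snd

/-- The rows of `S` occurring in the block `b` of size `t × t`, as columns of the transpose. -/
def blockRows (S : Finset (ℕ × ℕ)) (t : ℕ) (b : ℕ × ℕ) : Finset ℕ :=
  blockCols (S.image Prod.swap) t b.swap

section Blocks

variable {S : Finset (ℕ × ℕ)} {k t N : ℕ}

theorem mem_blockCols {b : ℕ × ℕ} {c : ℕ} :
    c ∈ blockCols S t b ↔ ∃ i, (i, c) ∈ S ∧ i / t = b.1 ∧ c / t = b.2 := by
  simp [blockCols, contract, Prod.ext_iff]

theorem blockCols_subset_Ico (ht : 0 < t) (b : ℕ × ℕ) :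
    blockCols S t b ⊆ Ico (b.2 * t) (b.2 * t + t) := by
  intro c hc
  obtain ⟨i, -, -, hcb⟩ := mem_blockCols.mp hc
  have := Nat.div_mul_le_self c t
  have := Nat.lt_div_mul_add (a := c) ht
  rw [mem_Ico, ← hcb]
  omega

theorem card_blockCols_le (ht : 0 < t) (b : ℕ × ℕ) : #(blockCols S t b) ≤ t := by
  simpa using card_le_card (blockCols_subset_Ico (S := S) ht b)

theorem card_block_le_card_blockRows_mul_card_blockCols (b : ℕ × ℕ) :
    #{p ∈ S | contract t p = b} ≤ #(blockRows S t b) * #(blockCols S t b) := by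
  rw [← card_product]
  refine card_le_card fun p hp => ?_
  obtain ⟨hpS, rfl⟩ := mem_filter.mp hp
  exact mem_product.mpr ⟨mem_blockCols.mpr ⟨p.2, mem_image_of_mem Prod.swap hpS, rfl, rfl⟩,
    mem_blockCols.mpr ⟨p.1, hpS, rfl, rfl⟩⟩

theorem hasGrid_of_subset_blockCols {P A : Finset ℕ} {q : ℕ} (hP : k ≤ #P) (hA : k ≤ #A)
    (h : ∀ p ∈ P, A ⊆ blockCols S t (p, q)) : HasGrid (S : Set (ℕ × ℕ)) k := by
  let r := P.orderEmbOfCardLe hP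
  let c := A.orderEmbOfCardLe hA
  have hcell (a b) : ∃ i, (i, c b) ∈ S ∧ i / t = r a := by
    obtain ⟨i, hi, hir, -⟩ := mem_blockCols.mp
      (h (r a) (P.orderEmbOfCardLe_mem hP a) (A.orderEmbOfCardLe_mem hA b))
    exact ⟨i, hi, hir⟩
  choose w hwS hwr using hcell
  refine ⟨w, fun _ b => c b, hwS, fun a a' b b' h => ?_, fun _ _ _ _ h => c.strictMono h⟩
  exact Nat.lt_of_div_lt_div (c := t) (by simpa only [hwr] using r.strictMono h)

theorem card_filter_le_card_blockCols (ht : 0 < t) (hS : ¬ HasGrid (S : Set (ℕ × ℕ)) k)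
    (P : Finset ℕ) (q : ℕ) : #{p ∈ P | k ≤ #(blockCols S t (p, q))} ≤ k * 2 ^ t := by
  by_contra! hlt
  have hmaps : ∀ p ∈ {p ∈ P | k ≤ #(blockCols S t (p, q))},
      blockCols S t (p, q) ∈ (Ico (q * t) (q * t + t)).powerset :=
    fun p _ => mem_powerset.mpr (blockCols_subset_Ico ht (p, q))
  obtain ⟨A, -, hA⟩ := exists_lt_card_fiber_of_mul_lt_card_of_maps_to (n := k) hmaps
    (by simpa [mul_comm] using hlt)
  obtain ⟨p₀, hp₀⟩ := card_pos.mp (Nat.zero_lt_of_lt hA)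
  simp only [mem_filter] at hp₀
  exact hS (hasGrid_of_subset_blockCols (t := t) (q := q) hA.le (hp₀.2 ▸ hp₀.1.2) fun p hp =>
    (mem_filter.mp hp).2.superset)

theorem card_wide_blocks_le (ht : 0 < t) (hS : ¬ HasGrid (S : Set (ℕ × ℕ)) k) (P Q : Finset ℕ) :
    #{b ∈ P ×ˢ Q | k ≤ #(blockCols S t b)} ≤ #Q * (k * 2 ^ t) := by
  rw [card_filter, sum_product_right]
  simp_rw [← card_filter]
  exact sum_le_card_nsmul _ _ _ fun q _ => card_filter_le_card_blockCols ht hS P q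

theorem card_tall_blocks_le (ht : 0 < t) (hS : ¬ HasGrid (S : Set (ℕ × ℕ)) k) (P Q : Finset ℕ) :
    #{b ∈ P ×ˢ Q | k ≤ #(blockRows S t b)} ≤ #P * (k * 2 ^ t) := by
  have hswap : ¬ HasGrid (S.image Prod.swap : Set (ℕ × ℕ)) k := fun h =>
    hS (HasGrid.of_image_swap (by rwa [coe_image] at h))
  rw [card_filter, sum_product]
  simp_rw [← card_filter]
  exact sum_le_card_nsmul _ _ _ fun p _ => card_filter_le_card_blockCols ht hswap Q p

theorem card_block_le (ht : 0 < t) (b : ℕ × ℕ) :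
    #{p ∈ S | contract t p = b} ≤ k ^ 2 + ((if k ≤ #(blockCols S t b) then t ^ 2 else 0) +
      if k ≤ #(blockRows S t b) then t ^ 2 else 0) := by
  have hle := card_block_le_card_blockRows_mul_card_blockCols (S := S) (t := t) b
  have hrows : #(blockRows S t b) ≤ t := card_blockCols_le ht _
  have hcols : #(blockCols S t b) ≤ t := card_blockCols_le ht b
  split_ifs with hwide htall htall
  · nlinarith
  · nlinarith
  · nlinarith
  · nlinarith [Nat.mul_le_mul (not_le.mp htall).le (not_le.mp hwide).le]

theorem card_le_card_image_contract (ht : 0 < t) (hS : ¬ HasGrid (S : Set (ℕ × ℕ)) k)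
    (hN : S.image (contract t) ⊆ range N ×ˢ range N) :
    #S ≤ k ^ 2 * #(S.image (contract t)) + 2 * (N * (k * 2 ^ t)) * t ^ 2 := by
  set B := S.image (contract t)
  have hsum (p : ℕ × ℕ → Prop) [DecidablePred p] (h : #{b ∈ range N ×ˢ range N | p b} ≤
      N * (k * 2 ^ t)) : ∑ b ∈ B, (if p b then t ^ 2 else 0) ≤ N * (k * 2 ^ t) * t ^ 2 := by
    rw [← sum_filter, sum_const, smul_eq_mul]
    exact Nat.mul_le_mul_right _ ((card_le_card (filter_subset_filter _ hN)).trans h)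
  have hwide := hsum _ (by simpa using card_wide_blocks_le ht hS (range N) (range N))
  have htall := hsum _ (by simpa using card_tall_blocks_le ht hS (range N) (range N))
  calc #S = ∑ b ∈ B, #{p ∈ S | contract t p = b} := card_eq_sum_card_image _ _
    _ ≤ _ := sum_le_sum fun b _ => card_block_le (k := k) ht b
    _ ≤ _ := by
      rw [sum_add_distrib, sum_add_distrib, sum_const, smul_eq_mul]
      linarith

end Blocks

theorem image_contract_subset {S : Finset (ℕ × ℕ)} {n t N : ℕ} (hN : ∀ x < n, x / t < N)
    (hS : S ⊆ range n ×ˢ range n) : S.image (contract t) ⊆ range N ×ˢ range N := by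
  refine image_subset_iff.mpr fun p hp => ?_
  have hp := mem_product.mp (hS hp)
  simp only [mem_range] at hp
  exact mem_product.mpr ⟨mem_range.mpr (hN _ hp.1), mem_range.mpr (hN _ hp.2)⟩

theorem not_hasGrid_image_contract {S : Finset (ℕ × ℕ)} {k : ℕ} (t : ℕ)
    (hS : ¬ HasGrid (S : Set (ℕ × ℕ)) k) :
    ¬ HasGrid (S.image (contract t) : Set (ℕ × ℕ)) k := fun h =>
  hS (HasGrid.of_image_contract (by rwa [coe_image] at h))

theorem marcus_tardos (k : ℕ) : ∃ c : ℕ, ∀ (n : ℕ) (S : Finset (ℕ × ℕ)),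
    S ⊆ range n ×ˢ range n → ¬ HasGrid (S : Set (ℕ × ℕ)) k → #S ≤ c * n := by
  obtain rfl | hk := Nat.eq_zero_or_pos k
  · exact ⟨0, fun n S _ h => absurd (HasGrid.zero _) h⟩
  -- With `t = 4 k²`, contraction costs a factor `k²` but shrinks the matrix by `2 k²`.
  set t := 4 * k ^ 2 with ht
  set e := k * 2 ^ t * t ^ 2 with he
  have htpos : 4 ≤ t := by nlinarith
  have hte : t ≤ 8 * e := by
    have : 1 ≤ k * 2 ^ t := Nat.mul_pos hk (by positivity)
    nlinarith
  refine ⟨8 * e, fun n => ?_⟩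
  induction n using Nat.strong_induction_on with
  | _ n ih =>
    intro S hS hG
    obtain hnt | hnt := lt_or_ge n t
    · calc #S ≤ n * n := by simpa using card_le_card hS
        _ ≤ 8 * e * n := Nat.mul_le_mul_right _ (by omega)
    · set N := n / t + 1 with hN
      have htN : t * N ≤ 2 * n := by
        have := Nat.mul_div_le n t
        rw [hN, mul_add]; omega
      have hNn : N < n := by nlinarith
      have hsub := image_contract_subset (t := t) (N := N)
        (fun x hx => Nat.lt_succ_of_le (Nat.div_le_div_right hx.le)) hS
      calc #S ≤ k ^ 2 * #(S.image (contract t)) + 2 * (N * (k * 2 ^ t)) * t ^ 2 :=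
            card_le_card_image_contract (by omega) hG hsub
        _ ≤ k ^ 2 * (8 * e * N) + 2 * (N * (k * 2 ^ t)) * t ^ 2 := by
            gcongr
            exact ih N hNn _ hsub (not_hasGrid_image_contract t hG)
        _ = 2 * e * (t * N) + 2 * e * N := by rw [he, ht]; ring
        _ ≤ 2 * e * (2 * n) + 2 * e * n := by gcongr
        _ ≤ 8 * e * n := by nlinarith

/-! ### Klazar's counting of sparse matrices -/

open Classical in
/-- The sets of positions in an `n × n` matrix without a `k`-grid. -/
noncomputable def gridFree (k n : ℕ) : Finset (Finset (ℕ × ℕ)) :=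
  {S ∈ (range n ×ˢ range n).powerset | ¬ HasGrid (S : Set (ℕ × ℕ)) k}

theorem mem_gridFree {k n : ℕ} {S : Finset (ℕ × ℕ)} :
    S ∈ gridFree k n ↔ S ⊆ range n ×ˢ range n ∧ ¬ HasGrid (S : Set (ℕ × ℕ)) k := by
  simp only [gridFree, mem_filter, mem_powerset]

theorem card_le_of_forall_image_contract_eq {T : Finset (ℕ × ℕ)} {F : Finset (Finset (ℕ × ℕ))}
    (hF : ∀ S ∈ F, S.image (contract 2) = T) : #F ≤ 2 ^ (4 * #T) := by
  let E : Finset (ℕ × ℕ) := T.biUnion fun p =>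
    ({2 * p.1, 2 * p.1 + 1} : Finset ℕ) ×ˢ ({2 * p.2, 2 * p.2 + 1} : Finset ℕ)
  have hE : #E ≤ 4 * #T := by
    rw [mul_comm]
    refine card_biUnion_le_card_mul _ _ _ fun p _ => ?_
    rw [card_product]
    exact Nat.mul_le_mul card_le_two card_le_two
  have hFE : F ⊆ E.powerset := fun S hS => mem_powerset.mpr fun p hp => by
    refine mem_biUnion.mpr ⟨contract 2 p, hF S hS ▸ mem_image_of_mem _ hp, ?_⟩
    simp only [contract, mem_product, mem_insert, mem_singleton]
    omega
  calc #F ≤ #E.powerset := card_le_card hFE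
    _ = 2 ^ #E := card_powerset _
    _ ≤ 2 ^ (4 * #T) := Nat.pow_le_pow_right two_pos hE

theorem card_gridFree_le_card_gridFree_half {k c n : ℕ}
    (hc : ∀ S ∈ gridFree k ((n + 1) / 2), #S ≤ c * ((n + 1) / 2)) :
    #(gridFree k n) ≤ 2 ^ (4 * (c * ((n + 1) / 2))) * #(gridFree k ((n + 1) / 2)) := by
  have hmaps : ∀ S ∈ gridFree k n, S.image (contract 2) ∈ gridFree k ((n + 1) / 2) := fun S hS => by
    obtain ⟨hSn, hSk⟩ := mem_gridFree.mp hS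
    exact mem_gridFree.mpr
      ⟨image_contract_subset (fun x hx => by omega) hSn, not_hasGrid_image_contract 2 hSk⟩
  refine card_le_mul_card_image_of_maps_to hmaps _ fun T hT => ?_
  refine (card_le_of_forall_image_contract_eq fun S hS => (mem_filter.mp hS).2).trans ?_
  exact Nat.pow_le_pow_right two_pos (Nat.mul_le_mul_left _ (hc T hT))

theorem card_gridFree_le (k : ℕ) : ∃ c : ℕ, ∀ n, #(gridFree k n) ≤ 2 ^ (c * n) := by
  obtain ⟨c, hc⟩ := marcus_tardos k
  refine ⟨12 * c + 1, fun n => ?_⟩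
  induction n using Nat.strong_induction_on with
  | _ n ih =>
    obtain hn | hn := lt_or_ge n 2
    · calc #(gridFree k n) ≤ #(range n ×ˢ range n).powerset :=
            card_le_card fun S hS => mem_powerset.mpr (mem_gridFree.mp hS).1
        _ = 2 ^ (n * n) := by simp [card_powerset]
        _ ≤ _ := Nat.pow_le_pow_right two_pos (Nat.mul_le_mul_right _ (by omega))
    · set N := (n + 1) / 2
      calc #(gridFree k n) ≤ 2 ^ (4 * (c * N)) * #(gridFree k N) :=
            card_gridFree_le_card_gridFree_half fun S hS =>
              hc N S (mem_gridFree.mp hS).1 (mem_gridFree.mp hS).2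
        _ ≤ 2 ^ (4 * (c * N)) * 2 ^ ((12 * c + 1) * N) := by gcongr; exact ih N (by omega)
        _ = 2 ^ (4 * (c * N) + (12 * c + 1) * N) := (pow_add _ _ _).symm
        _ ≤ 2 ^ ((12 * c + 1) * n) := by
            refine Nat.pow_le_pow_right two_pos ?_
            have h4N : 4 * N ≤ 3 * n := by omega
            nlinarith [Nat.mul_le_mul_left c h4N, (by omega : N ≤ n)]

end MarcusTardos

/-! ### Ramsey's theorem for pairs and for grids -/

section Ramsey

theorem exists_strictMono_forall_lt_eq.{u} (κ : Type*) [Finite κ] (l : ℕ) :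
    ∃ N : ℕ, ∀ (α : Type u) [LinearOrder α] (S : Finset α) (F : α → α → κ), N ≤ S.card →
      ∃ (g : Fin l → α) (c : Fin l → κ), StrictMono g ∧ (∀ i, g i ∈ S) ∧
        ∀ i j, i < j → F (g i) (g j) = c i := by
  classical
  have := Fintype.ofFinite κ
  induction l with
  | zero => exact ⟨0, fun _ _ _ _ _ => ⟨Fin.elim0, Fin.elim0, fun i => i.elim0, fun i => i.elim0,
      fun i => i.elim0⟩⟩
  | succ l ih =>
    obtain ⟨N, hN⟩ := ih
    refine ⟨Fintype.card κ * N + 2, fun α _ S F hS => ?_⟩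
    have hne : S.Nonempty := Finset.card_pos.mp (by omega)
    set s := S.min' hne
    have hcard : (Finset.univ : Finset κ).card * N < (S.erase s).card := by
      rw [Finset.card_erase_of_mem (Finset.min'_mem _ _), Finset.card_univ]
      omega
    obtain ⟨d, -, hd⟩ := Finset.exists_lt_card_fiber_of_mul_lt_card_of_maps_to
      (f := F s) (t := Finset.univ) (fun a _ => Finset.mem_univ _) hcard
    obtain ⟨g, c, hg, hgS, hgc⟩ := hN α _ F hd.le
    simp only [Finset.mem_filter, Finset.mem_erase] at hgS
    have hsg (i) : s < g i := (S.min'_le _ (hgS i).1.2).lt_of_ne' (hgS i).1.1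
    refine ⟨Fin.cons s g, Fin.cons d c, ?_, Fin.forall_iff_succ.mpr ?_, ?_⟩
    · exact Fin.strictMono_cons.mpr ⟨hsg, hg⟩
    · exact ⟨S.min'_mem hne, fun i => (hgS i).1.2⟩
    · intro i j hij
      obtain ⟨j, rfl⟩ := Fin.exists_succ_eq_of_ne_zero (Fin.ne_zero_of_lt hij)
      cases i using Fin.cases with
      | zero => exact (hgS j).2
      | succ i => exact hgc i j (Fin.succ_lt_succ_iff.mp hij)

theorem ramsey_pairs (κ : Type*) [Finite κ] (k : ℕ) :
    ∃ n : ℕ, ∀ F : Fin n → Fin n → κ, ∃ (f : Fin k ↪o Fin n) (c : κ),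
      ∀ i j, i < j → F (f i) (f j) = c := by
  classical
  have := Fintype.ofFinite κ
  obtain ⟨n, hn⟩ := exists_strictMono_forall_lt_eq κ (Fintype.card κ * k + 1)
  refine ⟨n, fun F => ?_⟩
  obtain ⟨g, c, hg, -, hgc⟩ := hn (Fin n) Finset.univ F (by simp)
  obtain ⟨d, hd⟩ := Fintype.exists_lt_card_fiber_of_mul_lt_card (n := k) c (by simp)
  let e := Finset.orderEmbOfCardLe _ hd.le
  refine ⟨e.trans (OrderEmbedding.ofStrictMono g hg), d, fun i j hij => ?_⟩
  exact (hgc _ _ (e.strictMono hij)).trans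
    (Finset.mem_filter.mp (Finset.orderEmbOfCardLe_mem _ hd.le i)).2

theorem ramsey_grid (κ : Type*) [Finite κ] (k : ℕ) :
    ∃ n : ℕ, ∀ F : Fin n → Fin n → Fin n → Fin n → κ, ∃ (f g : Fin k ↪o Fin n) (c : κ),
      ∀ a a' b b', a < a' → b < b' → F (f a) (f a') (g b) (g b') = c := by
  obtain ⟨n₁, h₁⟩ := ramsey_pairs κ k
  obtain ⟨n₂, h₂⟩ := ramsey_pairs (Fin n₁ → Fin n₁ → κ) k
  refine ⟨max n₁ n₂, fun F => ?_⟩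
  let i₁ : Fin n₁ ↪o Fin (max n₁ n₂) := Fin.castLEOrderEmb (le_max_left _ _)
  let i₂ : Fin n₂ ↪o Fin (max n₁ n₂) := Fin.castLEOrderEmb (le_max_right _ _)
  obtain ⟨g, C, hgC⟩ := h₂ fun b b' a a' => F (i₁ a) (i₁ a') (i₂ b) (i₂ b')
  obtain ⟨f, c, hfc⟩ := h₁ C
  refine ⟨f.trans i₁, g.trans i₂, c, fun a a' b b' ha hb => ?_⟩
  rw [← hfc a a' ha, ← hgC b b' hb]
  rfl

/-- A binary relation between the positions `(a, b)` and `(a', b')` of a square grid is uniform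
with pattern `α` if, for positions in different rows and columns, it depends only on their
relative position. -/
def IsUniform {k : ℕ} (R : Fin k → Fin k → Fin k → Fin k → Prop) (α : Bool → Bool → Bool) : Prop :=
  ∀ a b a' b', a ≠ a' → b ≠ b' → (R a b a' b' ↔ α (decide (a < a')) (decide (b < b')) = true)

theorem exists_isUniform (ι : Type*) [Finite ι] (k : ℕ) :
    ∃ n : ℕ, ∀ R : ι → Fin n → Fin n → Fin n → Fin n → Prop,
      ∃ (f g : Fin k ↪o Fin n) (α : ι → Bool → Bool → Bool),
        ∀ t, IsUniform (fun a b a' b' => R t (f a) (g b) (f a') (g b')) (α t) := by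
  classical
  obtain ⟨n, hn⟩ := ramsey_grid (ι → Bool → Bool → Bool) k
  refine ⟨n, fun R => ?_⟩
  obtain ⟨f, g, α, hα⟩ := hn fun a a' b b' t r s => decide
    (R t (bif r then a else a') (bif s then b else b') (bif r then a' else a)
      (bif s then b' else b))
  refine ⟨f, g, α, fun t a b a' b' ha hb => ?_⟩
  obtain ha | ha := ha.lt_or_gt <;> obtain hb | hb := hb.lt_or_gt
  · simp [← hα a a' b b' ha hb, ha, hb]
  · simp [← hα a a' b' b ha hb, ha, hb.not_gt]
  · simp [← hα a' a b b' ha hb, ha.not_gt, hb]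
  · simp [← hα a' a b' b ha hb, ha.not_gt, hb.not_gt]

end Ramsey

namespace OrderedGraphClass

/-! ### Universal grids and uniform grids -/

/-- A grid of rows and columns of the adjacency matrix of an ordered graph. There are two rows
`row a b` and `twin a b` for each position: they are told apart by the column in the same place,
but not by the columns in the previous columns of the grid. -/
structure UniversalGrid {V : Type*} [Preorder V] (G : SimpleGraph V) (n : ℕ) where
  (row twin col : Fin n → Fin n → V)
  row_lt_row : ∀ a a' b b', a < a' → row a b < row a' b'
  twin_lt_twin : ∀ a a' b b', a < a' → twin a b < twin a' b'
  col_lt_col : ∀ a a' b b', b < b' → col a b < col a' b'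
  lt_col_or_col_lt : (∀ a a' b b', row a b < col a' b' ∧ twin a b < col a' b') ∨
    ∀ a a' b b', col a' b' < row a b ∧ col a' b' < twin a b
  adj_row_col : ∀ a b, G.Adj (row a b) (col a b)
  not_adj_twin_col : ∀ a b, ¬ G.Adj (twin a b) (col a b)
  adj_iff : ∀ a a' b b', b' < b → (G.Adj (row a b) (col a' b') ↔ G.Adj (twin a b) (col a' b'))

/-- A grid of rows and columns of the adjacency matrix of an ordered graph, the rows preceding
the columns, in which adjacencies away from a common line of the grid depend only on the relative
position, as described by `rowAdj`, `colAdj` and `crossAdj`. -/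
structure UniformGrid {V : Type*} [Preorder V] (G : SimpleGraph V) (k : ℕ) where
  (row col : Fin k → Fin k → V)
  (rowAdj colAdj : Bool → Bool)
  crossAdj : Bool → Bool → Bool
  row_lt_row : ∀ a a' b b', a < a' → row a b < row a' b'
  col_lt_col : ∀ a a' b b', b < b' → col a b < col a' b'
  row_lt_col : ∀ a a' b b', row a b < col a' b'
  adj_row_row : ∀ a a' b b', a < a' → b ≠ b' →
    (G.Adj (row a b) (row a' b') ↔ rowAdj (decide (b < b')) = true)
  adj_col_col : ∀ a a' b b', b < b' → a ≠ a' →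
    (G.Adj (col a b) (col a' b') ↔ colAdj (decide (a < a')) = true)
  adj_row_col : ∀ a a' b b', a ≠ a' → b ≠ b' →
    (G.Adj (row a b) (col a' b') ↔ crossAdj (decide (a < a')) (decide (b < b')) = true)

section UniformGrid

variable {V : Type*} [Preorder V] {G : SimpleGraph V} {k : ℕ}

/-- The uniform grid with given rows and columns, if the rows precede the columns. -/
def UniformGrid.ofRowsBefore {X Z : Fin k → Fin k → V} {α γ β : Bool → Bool → Bool}
    (hX : ∀ a a' b b', a < a' → X a b < X a' b') (hZ : ∀ a a' b b', b < b' → Z a b < Z a' b')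
    (hXZ : ∀ a a' b b', X a b < Z a' b')
    (hα : IsUniform (fun a b a' b' => G.Adj (X a b) (X a' b')) α)
    (hγ : IsUniform (fun a b a' b' => G.Adj (Z a b) (Z a' b')) γ)
    (hβ : IsUniform (fun a b a' b' => G.Adj (X a b) (Z a' b')) β) : UniformGrid G k where
  row := X
  col := Z
  rowAdj := α true
  colAdj t := γ t true
  crossAdj := β
  row_lt_row := hX
  col_lt_col := hZ
  row_lt_col := hXZ
  adj_row_row a a' b b' ha hb := by simpa [ha] using hα a b a' b' ha.ne hb
  adj_col_col a a' b b' hb ha := by simpa [hb] using hγ a b a' b' ha hb.ne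
  adj_row_col a a' b b' ha hb := hβ a b a' b' ha hb

/-- The uniform grid with given rows and columns, if the columns precede the rows: transposing the
grid exchanges their roles. -/
def UniformGrid.ofColsBefore {X Z : Fin k → Fin k → V} {α γ β : Bool → Bool → Bool}
    (hX : ∀ a a' b b', a < a' → X a b < X a' b') (hZ : ∀ a a' b b', b < b' → Z a b < Z a' b')
    (hZX : ∀ a a' b b', Z a' b' < X a b)
    (hα : IsUniform (fun a b a' b' => G.Adj (X a b) (X a' b')) α)
    (hγ : IsUniform (fun a b a' b' => G.Adj (Z a b) (Z a' b')) γ)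
    (hβ : IsUniform (fun a b a' b' => G.Adj (X a b) (Z a' b')) β) : UniformGrid G k where
  row a b := Z b a
  col a b := X b a
  rowAdj t := γ t true
  colAdj := α true
  crossAdj r s := β (!s) (!r)
  row_lt_row _ _ _ _ h := hZ _ _ _ _ h
  col_lt_col _ _ _ _ h := hX _ _ _ _ h
  row_lt_col _ _ _ _ := hZX _ _ _ _
  adj_row_row a a' b b' ha hb := by simpa [ha] using hγ b a b' a' hb ha.ne
  adj_col_col a a' b b' hb ha := by simpa [hb] using hα b a b' a' hb.ne ha
  adj_row_col a a' b b' ha hb := by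
    have not_decide_lt {x y : Fin k} (h : x ≠ y) : (!decide (x < y)) = decide (y < x) := by
      rw [← decide_not, decide_eq_decide, not_lt]
      exact h.symm.le_iff_lt
    rw [G.adj_comm, not_decide_lt ha, not_decide_lt hb]
    exact hβ b' a' b a hb.symm ha.symm

/-- A pair of uniform grids with a common pattern off the diagonal and opposite patterns on it. -/
structure OppositeGrids (G : SimpleGraph V) (k : ℕ) where
  (pos neg : UniformGrid G k)
  adj_pos : ∀ a b, G.Adj (pos.row a b) (pos.col a b)
  not_adj_neg : ∀ a b, ¬ G.Adj (neg.row a b) (neg.col a b)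
  exists_crossAdj_eq : ∃ r s, pos.crossAdj r s = neg.crossAdj r s

theorem exists_oppositeGrids.{u} (k : ℕ) : ∃ n : ℕ, ∀ (V : Type u) [Preorder V]
    (G : SimpleGraph V), Nonempty (UniversalGrid G n) → Nonempty (OppositeGrids G (k + 2)) := by
  obtain ⟨n, hn⟩ := exists_isUniform (Fin 5) (k + 2)
  refine ⟨n, fun V _ G ⟨U⟩ => ?_⟩
  obtain ⟨f, g, α, hα⟩ := hn ![fun a b a' b' => G.Adj (U.row a b) (U.row a' b'),
    fun a b a' b' => G.Adj (U.twin a b) (U.twin a' b'),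
    fun a b a' b' => G.Adj (U.col a b) (U.col a' b'),
    fun a b a' b' => G.Adj (U.row a b) (U.col a' b'),
    fun a b a' b' => G.Adj (U.twin a b) (U.col a' b')]
  have hrow (a a' b b') (h : a < a') : U.row (f a) (g b) < U.row (f a') (g b') :=
    U.row_lt_row _ _ _ _ (f.strictMono h)
  have htwin (a a' b b') (h : a < a') : U.twin (f a) (g b) < U.twin (f a') (g b') :=
    U.twin_lt_twin _ _ _ _ (f.strictMono h)
  have hcol (a a' b b') (h : b < b') : U.col (f a) (g b) < U.col (f a') (g b') :=
    U.col_lt_col _ _ _ _ (g.strictMono h)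
  have hcross : α 3 true false = α 4 true false := Bool.eq_iff_iff.mpr <|
    (hα 3 0 1 1 0 (by simp) (by simp)).symm.trans <|
      (U.adj_iff _ _ _ _ (g.strictMono (by simp))).trans (hα 4 0 1 1 0 (by simp) (by simp))
  obtain hlt | hlt := U.lt_col_or_col_lt
  · exact ⟨.ofRowsBefore hrow hcol (fun _ _ _ _ => (hlt _ _ _ _).1) (hα 0) (hα 2) (hα 3),
      .ofRowsBefore htwin hcol (fun _ _ _ _ => (hlt _ _ _ _).2) (hα 1) (hα 2) (hα 4),
      fun _ _ => U.adj_row_col _ _, fun _ _ => U.not_adj_twin_col _ _, true, false, hcross⟩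
  · exact ⟨.ofColsBefore hrow hcol (fun _ _ _ _ => (hlt _ _ _ _).1) (hα 0) (hα 2) (hα 3),
      .ofColsBefore htwin hcol (fun _ _ _ _ => (hlt _ _ _ _).2) (hα 1) (hα 2) (hα 4),
      fun _ _ => (U.adj_row_col _ _).symm, fun _ _ h => U.not_adj_twin_col _ _ h.symm,
      true, false, hcross⟩

end UniformGrid

end OrderedGraphClass

namespace OrderedGraphClass

/-! ### Induced ordered subgraphs and the unavoidable classes -/

section Generators

theorem adj_comp_iff_of_forall_lt {V : Type*} {G : SimpleGraph V} {k : ℕ} {u : Fin k → V}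
    {b : Bool} (h : ∀ i j, i < j → (G.Adj (u i) (u j) ↔ b = true)) (i j : Fin k) :
    G.Adj (u i) (u j) ↔ i ≠ j ∧ b = true := by
  obtain hij | rfl | hij := lt_trichotomy i j
  · simp [h i j hij, hij.ne]
  · simp
  · simp [G.adj_comm (u i), h j i hij, hij.ne']

variable {V W X : Type*} [Preorder V] [Preorder W] [Preorder X] {G : SimpleGraph V} {k m n : ℕ}

/-- `H` is isomorphic to an induced ordered subgraph of `G`. -/
def IsInducedOrdered (H : SimpleGraph W) (G : SimpleGraph V) : Prop :=
  ∃ f : W ↪o V, H = G.comap f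

theorem IsInducedOrdered.trans {K : SimpleGraph X} {H : SimpleGraph W}
    (hKH : IsInducedOrdered K H) (hHG : IsInducedOrdered H G) : IsInducedOrdered K G := by
  obtain ⟨f, rfl⟩ := hKH
  obtain ⟨g, rfl⟩ := hHG
  exact ⟨f.trans g, SimpleGraph.comap_comap ..⟩

theorem IsHereditary.mem_of_isInducedOrdered {C : OrderedGraphClass} (hC : C.IsHereditary)
    {G : SimpleGraph (Fin n)} (hG : G ∈ C n) {H : SimpleGraph (Fin m)}
    (h : IsInducedOrdered H G) : H ∈ C m := by
  obtain ⟨f, rfl⟩ := h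
  exact hC f G hG

theorem isInducedOrdered_permGraph {π : Equiv.Perm (Fin k)} {u : Fin k → V} (hu : StrictMono u)
    (hadj : ∀ i j, i < j → (G.Adj (u i) (u j) ↔ π j < π i)) :
    IsInducedOrdered (permGraph π) G := by
  refine ⟨OrderEmbedding.ofStrictMono u hu, ?_⟩
  ext i j
  simp only [permGraph, SimpleGraph.comap_adj, OrderEmbedding.coe_ofStrictMono]
  obtain hij | rfl | hij := lt_trichotomy i j
  · simp [hij, hij.not_gt, hadj i j hij]
  · simp
  · rw [G.adj_comm]
    simp [hij, hij.not_gt, hadj j i hij]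

theorem isInducedOrdered_permGraph_of_ne {e : Bool → Bool} (he : e true ≠ e false)
    (h : ∀ τ : Equiv.Perm (Fin k), ∃ u : Fin k → V, StrictMono u ∧
      ∀ i j, i < j → (G.Adj (u i) (u j) ↔ e (decide (τ i < τ j)) = true))
    (π : Equiv.Perm (Fin k)) : IsInducedOrdered (permGraph π) G := by
  have lt_asymm_iff {i j : Fin k} (hij : i < j) : π j < π i ↔ ¬ π i < π j := by
    rw [not_lt, (π.injective.ne hij.ne').le_iff_lt]
  cases htrue : e true with
  | false =>
    obtain ⟨u, hu, hadj⟩ := h π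
    refine isInducedOrdered_permGraph hu fun i j hij => ?_
    rw [hadj i j hij, lt_asymm_iff hij]
    grind
  | true =>
    obtain ⟨u, hu, hadj⟩ := h (π.trans Fin.revPerm)
    refine isInducedOrdered_permGraph hu fun i j hij => ?_
    simp only [hadj i j hij, Equiv.trans_apply, Fin.revPerm_apply, Fin.rev_lt_rev]
    grind

theorem isInducedOrdered_matchingGraph {s : Pattern} {lam rho : Bool} {σ : Equiv.Perm (Fin k)}
    {u w : Fin k → V} (hu : StrictMono u) (hw : StrictMono w) (huw : ∀ i j, u i < w j)
    (hadj_left : ∀ i j, i < j → (G.Adj (u i) (u j) ↔ lam = true))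
    (hadj_right : ∀ i j, i < j → (G.Adj (w i) (w j) ↔ rho = true))
    (hcross : ∀ i j, G.Adj (u i) (w j) ↔ s.cross σ i j) :
    IsInducedOrdered (matchingGraph s lam rho σ) G := by
  let g (x : Fin k ⊕ₗ Fin k) : V := Sum.elim u w (ofLex x)
  have hg : StrictMono g := by
    intro x y hxy
    induction x using Lex.rec with | _ x
    induction y using Lex.rec with | _ y
    rcases x with x | x <;> rcases y with y | y
    · exact hu (by simpa using hxy)
    · exact huw x y
    · simp at hxy
    · exact hw (by simpa using hxy)
  refine ⟨OrderEmbedding.ofStrictMono g hg, ?_⟩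
  ext x y
  induction x using Lex.rec with | _ x
  induction y using Lex.rec with | _ y
  rcases x with x | x <;> rcases y with y | y
  · exact (adj_comp_iff_of_forall_lt hadj_left x y).symm
  · exact (hcross x y).symm
  · exact (hcross y x).symm.trans (G.adj_comm _ _)
  · exact (adj_comp_iff_of_forall_lt hadj_right x y).symm

theorem exists_perm_castLE (h : n ≤ m) (σ : Equiv.Perm (Fin n)) :
    ∃ τ : Equiv.Perm (Fin m), ∀ i, τ (Fin.castLE h i) = Fin.castLE h (σ i) :=
  ⟨σ.viaFintypeEmbedding (Fin.castLEEmb h),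
    fun i => Equiv.Perm.viaFintypeEmbedding_apply_image _ _ i⟩

theorem Pattern.cross_castLE (h : n ≤ m) {σ : Equiv.Perm (Fin n)} {τ : Equiv.Perm (Fin m)}
    (hτ : ∀ i, τ (Fin.castLE h i) = Fin.castLE h (σ i)) (s : Pattern) (i j : Fin n) :
    s.cross τ (Fin.castLE h i) (Fin.castLE h j) ↔ s.cross σ i j := by
  have hsymm : τ.symm (Fin.castLE h j) = Fin.castLE h (σ.symm j) := by
    rw [Equiv.symm_apply_eq, hτ, Equiv.apply_symm_apply]
  cases s <;> simp [Pattern.cross, hτ, hsymm]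

/-- The classes of ordered graphs that are to be shown unavoidable: `none` stands for the
permutation graphs. -/
def unavoidableClass : Option (Pattern × Bool × Bool) → OrderedGraphClass
  | none => permClass
  | some (s, lam, rho) => matchingClass s lam rho

/-- All the graphs of order `k` generating `unavoidableClass c` are induced in `G`. -/
def ContainsGenerators (G : SimpleGraph V) (k : ℕ) : Option (Pattern × Bool × Bool) → Prop
  | none => ∀ π : Equiv.Perm (Fin k), IsInducedOrdered (permGraph π) G
  | some (s, lam, rho) => ∀ σ : Equiv.Perm (Fin k),
      IsInducedOrdered (matchingGraph s lam rho σ) G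

theorem ContainsGenerators.mono {c : Option (Pattern × Bool × Bool)}
    (h : ContainsGenerators G m c) (hnm : n ≤ m) : ContainsGenerators G n c := by
  have hmono : StrictMono (Fin.castLE hnm) := Fin.strictMono_castLE hnm
  obtain _ | ⟨s, lam, rho⟩ := c
  · intro π
    obtain ⟨τ, hτ⟩ := exists_perm_castLE hnm π
    refine (isInducedOrdered_permGraph hmono fun i j hij => ?_).trans (h τ)
    simp [permGraph, hτ, hij, hij.not_gt]
  · intro σ
    obtain ⟨τ, hτ⟩ := exists_perm_castLE hnm σ
    refine (isInducedOrdered_matchingGraph (u := fun i => toLex (.inl (Fin.castLE hnm i)))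
      (w := fun i => toLex (.inr (Fin.castLE hnm i)))
      (fun i j hij => by simpa using hij) (fun i j hij => by simpa using hij)
      (fun i j => Sum.Lex.inl_lt_inr _ _) (fun i j hij => ?_) (fun i j hij => ?_)
      fun i j => ?_).trans (h τ)
    · simp [matchingGraph, matchingAdj, hij.ne]
    · simp [matchingGraph, matchingAdj, hij.ne]
    · exact Pattern.cross_castLE hnm hτ s i j

theorem exists_perm_lt_iff_lt {α : Type*} [LinearOrder α] {g : Fin m → α}
    (hg : Function.Injective g) :
    ∃ τ : Equiv.Perm (Fin m), ∀ i j, τ i < τ j ↔ g i < g j := by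
  have hmono : StrictMono (g ∘ Tuple.sort g) :=
    (Tuple.monotone_sort g).strictMono_of_injective (hg.comp (Tuple.sort g).injective)
  refine ⟨(Tuple.sort g).symm, fun i j => ?_⟩
  rw [← hmono.lt_iff_lt]
  simp

theorem isHereditary_permClass : IsHereditary permClass := by
  rintro m n f _ ⟨π, rfl⟩
  obtain ⟨τ, hτ⟩ := exists_perm_lt_iff_lt (π.injective.comp f.injective)
  refine ⟨τ, ?_⟩
  ext i j
  simp [permGraph, hτ]

theorem isHereditary_matchingClass (s : Pattern) (lam rho : Bool) :
    IsHereditary (matchingClass s lam rho) := by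
  rintro m n f _ ⟨N, σ, g, rfl⟩
  exact ⟨N, σ, f.trans g, SimpleGraph.comap_comap ..⟩

theorem isHereditary_unavoidableClass : ∀ c, IsHereditary (unavoidableClass c)
  | none => isHereditary_permClass
  | some (s, lam, rho) => isHereditary_matchingClass s lam rho

end Generators

/-! ### Generators in uniform grids -/

section UniformGrid

variable {V : Type*} [Preorder V] {G : SimpleGraph V} {k K : ℕ}

theorem UniformGrid.containsGenerators_none_or_const (U : UniformGrid G K) (hk : k ≤ K) :
    ContainsGenerators G k none ∨
      (∀ t, U.rowAdj t = U.rowAdj true) ∧ ∀ t, U.colAdj t = U.colAdj true := by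
  have hmono : StrictMono (Fin.castLE hk) := Fin.strictMono_castLE hk
  by_cases hrow : U.rowAdj true = U.rowAdj false
  · by_cases hcol : U.colAdj true = U.colAdj false
    · exact .inr ⟨Bool.forall_bool.mpr ⟨hrow.symm, rfl⟩, Bool.forall_bool.mpr ⟨hcol.symm, rfl⟩⟩
    · refine .inl <| isInducedOrdered_permGraph_of_ne hcol fun τ => ⟨fun i =>
        U.col (Fin.castLE hk (τ i)) (Fin.castLE hk i), fun i j hij => ?_, fun i j hij => ?_⟩
      · exact U.col_lt_col _ _ _ _ (hmono hij)
      · simp [U.adj_col_col _ _ _ _ (hmono hij) (hmono.injective.ne (τ.injective.ne hij.ne))]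
  · refine .inl <| isInducedOrdered_permGraph_of_ne hrow fun τ => ⟨fun i =>
      U.row (Fin.castLE hk i) (Fin.castLE hk (τ i)), fun i j hij => ?_, fun i j hij => ?_⟩
    · exact U.row_lt_row _ _ _ _ (hmono hij)
    · simp [U.adj_row_row _ _ _ _ (hmono hij) (hmono.injective.ne (τ.injective.ne hij.ne))]

theorem UniformGrid.exists_containsGenerators (U : UniformGrid G K) (hk : k ≤ K) (s : Pattern)
    (h : ∀ σ : Equiv.Perm (Fin k), ∃ pr pc qr qc : Fin k → Fin K, StrictMono pr ∧
      Function.Injective pc ∧ Function.Injective qr ∧ StrictMono qc ∧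
      ∀ i j, G.Adj (U.row (pr i) (pc i)) (U.col (qr j) (qc j)) ↔ s.cross σ i j) :
    ∃ c, ContainsGenerators G k c := by
  obtain hnone | ⟨hrow, hcol⟩ := U.containsGenerators_none_or_const hk
  · exact ⟨none, hnone⟩
  refine ⟨some (s, U.rowAdj true, U.colAdj true), fun σ => ?_⟩
  obtain ⟨pr, pc, qr, qc, hpr, hpc, hqr, hqc, hcross⟩ := h σ
  refine isInducedOrdered_matchingGraph (fun i j hij => U.row_lt_row _ _ _ _ (hpr hij))
    (fun i j hij => U.col_lt_col _ _ _ _ (hqc hij)) (fun i j => U.row_lt_col _ _ _ _)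
    (fun i j hij => ?_) (fun i j hij => ?_) hcross
  · rw [U.adj_row_row _ _ _ _ (hpr hij) (hpc.ne hij.ne), hrow]
  · rw [U.adj_col_col _ _ _ _ (hqc hij) (hqr.ne hij.ne), hcol]

theorem exists_interleaving (k : ℕ) (v : Bool) :
    ∃ p q : Fin k → Fin (2 * k), StrictMono p ∧ StrictMono q ∧ (∀ i j, p i ≠ q j) ∧
      ∀ i j, p i < q j ↔ if v then i ≤ j else i < j := by
  let even (i : Fin k) : Fin (2 * k) := ⟨2 * i, by omega⟩
  let odd (i : Fin k) : Fin (2 * k) := ⟨2 * i + 1, by omega⟩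
  have heven : StrictMono even := fun i j hij => by simpa [even] using hij
  have hodd : StrictMono odd := fun i j hij => by simpa [odd] using hij
  have hne (i j) : even i ≠ odd j := by simp only [even, odd, Ne, Fin.mk.injEq]; omega
  cases v
  · refine ⟨odd, even, hodd, heven, fun i j => (hne j i).symm, fun i j => ?_⟩
    simp only [even, odd, Fin.lt_def, Bool.false_eq_true, if_false]
    omega
  · refine ⟨even, odd, heven, hodd, hne, fun i j => ?_⟩
    simp only [even, odd, Fin.lt_def, Fin.le_def, if_true]
    omega

theorem exists_separated (k : ℕ) (v : Bool) :
    ∃ p q : Fin k → Fin (2 * k), StrictMono p ∧ StrictMono q ∧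
      ∀ i j, p i ≠ q j ∧ decide (p i < q j) = v := by
  let low (i : Fin k) : Fin (2 * k) := ⟨i, by omega⟩
  let high (i : Fin k) : Fin (2 * k) := ⟨k + i, by omega⟩
  have hlow : StrictMono low := fun i j hij => by simpa [low] using hij
  have hhigh : StrictMono high := fun i j hij => by simpa [high] using hij
  have hlt (i j) : low i < high j := by simp only [low, high, Fin.lt_def]; omega
  cases v
  · exact ⟨high, low, hhigh, hlow, fun i j => ⟨(hlt j i).ne', by simpa using (hlt j i).le⟩⟩
  · exact ⟨low, high, hlow, hhigh, fun i j => ⟨(hlt i j).ne, by simpa using hlt i j⟩⟩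

theorem UniformGrid.exists_containsGenerators_of_row_ne (U : UniformGrid G (2 * k)) {s : Bool}
    (hs : U.crossAdj true s ≠ U.crossAdj false s) : ∃ c, ContainsGenerators G k c := by
  obtain ⟨p, q, hp, hq, hne, hlt⟩ := exists_interleaving k (U.crossAdj true s)
  obtain ⟨pc, qc, hpc, hqc, hsep⟩ := exists_separated k s
  refine U.exists_containsGenerators (by omega) (bif U.crossAdj true s then .leL else .geL)
    fun σ => ⟨p, pc, q ∘ σ.symm, qc, hp, hpc.injective, hq.injective.comp σ.symm.injective, hqc,
      fun i j => ?_⟩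
  have hadj := U.adj_row_col _ _ _ _ (hne i (σ.symm j)) (hsep i j).1
  rw [(hsep i j).2] at hadj
  rw [Function.comp_apply, hadj]
  specialize hlt i (σ.symm j)
  grind [Pattern.cross]

theorem UniformGrid.exists_containsGenerators_of_col_ne (U : UniformGrid G (2 * k)) {r : Bool}
    (hr : U.crossAdj r true ≠ U.crossAdj r false) : ∃ c, ContainsGenerators G k c := by
  obtain ⟨p, q, hp, hq, hne, hlt⟩ := exists_interleaving k (U.crossAdj r true)
  obtain ⟨pr, qr, hpr, hqr, hsep⟩ := exists_separated k r
  refine U.exists_containsGenerators (by omega) (bif U.crossAdj r true then .geR else .leR)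
    fun σ => ⟨pr, p ∘ σ, qr, q, hpr, hp.injective.comp σ.injective, hqr.injective, hq,
      fun i j => ?_⟩
  have hadj := U.adj_row_col _ _ _ _ (hsep i j).1 (hne (σ i) j)
  rw [(hsep i j).2] at hadj
  rw [Function.comp_apply, hadj]
  specialize hlt (σ i) j
  grind [Pattern.cross]

theorem UniformGrid.exists_containsGenerators_or_const (U : UniformGrid G (2 * k)) :
    (∃ c, ContainsGenerators G k c) ∨ ∃ b, ∀ r s, U.crossAdj r s = b := by
  have row_ne_or_col_ne_or_const : ∀ α : Bool → Bool → Bool, (∃ s, α true s ≠ α false s) ∨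
      (∃ r, α r true ≠ α r false) ∨ ∃ b, ∀ r s, α r s = b := by
    decide
  obtain ⟨s, hs⟩ | ⟨r, hr⟩ | hconst := row_ne_or_col_ne_or_const U.crossAdj
  · exact .inl (U.exists_containsGenerators_of_row_ne hs)
  · exact .inl (U.exists_containsGenerators_of_col_ne hr)
  · exact .inr hconst

theorem UniformGrid.exists_containsGenerators_of_diagonal (U : UniformGrid G K) (hk : k ≤ K)
    {b : Bool} (hb : ∀ r s, U.crossAdj r s = b)
    (hdiag : ∀ i j, G.Adj (U.row i j) (U.col i j) ↔ b = false) :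
    ∃ c, ContainsGenerators G k c := by
  have hmono : StrictMono (Fin.castLE hk) := Fin.strictMono_castLE hk
  refine U.exists_containsGenerators hk (bif b then .ne else .eq) fun σ =>
    ⟨Fin.castLE hk, Fin.castLE hk ∘ σ, Fin.castLE hk ∘ σ.symm, Fin.castLE hk, hmono,
      hmono.injective.comp σ.injective, hmono.injective.comp σ.symm.injective, hmono,
      fun i j => ?_⟩
  simp only [Function.comp_apply]
  by_cases hij : σ i = j
  · subst hij
    cases b <;> simp [Pattern.cross, hdiag]
  · rw [U.adj_row_col _ _ _ _ (hmono.injective.ne fun h => hij (σ.eq_symm_apply.mp h))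
      (hmono.injective.ne hij), hb]
    cases b <;> simp [Pattern.cross, hij]

theorem OppositeGrids.exists_containsGenerators (P : OppositeGrids G (2 * k)) :
    ∃ c, ContainsGenerators G k c := by
  have hk : k ≤ 2 * k := by omega
  obtain hpos | ⟨b, hb⟩ := P.pos.exists_containsGenerators_or_const
  · exact hpos
  obtain hneg | ⟨b', hb'⟩ := P.neg.exists_containsGenerators_or_const
  · exact hneg
  obtain ⟨r, s, hrs⟩ := P.exists_crossAdj_eq
  obtain rfl : b = b' := by rw [← hb r s, hrs, hb']
  cases b
  · exact P.pos.exists_containsGenerators_of_diagonal hk hb fun i j => by simp [P.adj_pos]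
  · exact P.neg.exists_containsGenerators_of_diagonal hk hb' fun i j => by simp [P.not_adj_neg]

end UniformGrid

instance : DecidableEq Pattern := fun s t => by
  cases s <;> cases t <;> first
    | exact isTrue rfl
    | exact isFalse (fun h => Pattern.noConfusion h)

instance : Fintype Pattern where
  elems := {.eq, .ne, .leL, .geL, .leR, .geR}
  complete s := by cases s <;> decide

theorem unavoidableClass_le_of_containsGenerators {C : OrderedGraphClass} (hC : C.IsHereditary)
    {c : Option (Pattern × Bool × Bool)}
    (h : ∀ m, ∃ k ≥ m, ∃ n, ∃ G ∈ C n, ContainsGenerators G k c) : unavoidableClass c ≤ C := by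
  intro m H hH
  obtain _ | ⟨s, lam, rho⟩ := c
  · obtain ⟨π, rfl⟩ := hH
    obtain ⟨k, hk, n, G, hG, hcont⟩ := h m
    exact hC.mem_of_isInducedOrdered hG (hcont.mono hk π)
  · obtain ⟨r, σ, hHσ⟩ := hH
    obtain ⟨k, hk, n, G, hG, hcont⟩ := h r
    exact hC.mem_of_isInducedOrdered hG (.trans hHσ (hcont.mono hk σ))

theorem exists_unavoidableClass_le {C : OrderedGraphClass} (hC : C.IsHereditary)
    (h : ∀ n, ∃ N, ∃ G ∈ C N, Nonempty (UniversalGrid G n)) : ∃ c, unavoidableClass c ≤ C := by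
  have hcont (k : ℕ) : ∃ c, ∃ n, ∃ G ∈ C n, ContainsGenerators G (k + 1) c := by
    obtain ⟨n, hn⟩ := exists_oppositeGrids (2 * k)
    obtain ⟨N, G, hG, hgrid⟩ := h n
    obtain ⟨P⟩ := hn _ G hgrid
    obtain ⟨c, hc⟩ := OppositeGrids.exists_containsGenerators (k := k + 1) P
    exact ⟨c, N, G, hG, hc⟩
  choose c hc using hcont
  obtain ⟨d, hd⟩ := Finite.exists_infinite_fiber c
  refine ⟨d, unavoidableClass_le_of_containsGenerators hC fun m => ?_⟩
  obtain ⟨k, rfl, hmk⟩ := (Set.infinite_coe_iff.mp hd).exists_gt m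
  exact ⟨k + 1, by omega, hc k⟩

end OrderedGraphClass

/-! ### From marked cells to universal grids -/

section Marks

open Finset

theorem exists_strictMono_forall_notMem {α : Type*} [LinearOrder α] {bad : α → Finset α} {d : ℕ}
    (hbad : ∀ b, #(bad b) ≤ d) (n : ℕ) (S : Finset α) (hS : n * (d + 1) ≤ #S) :
    ∃ g : Fin n → α, StrictMono g ∧ (∀ i, g i ∈ S) ∧ ∀ i j, i < j → g i ∉ bad (g j) := by
  induction n generalizing S with
  | zero => exact ⟨fun i => i.elim0, fun i => i.elim0, fun i => i.elim0, fun i => i.elim0⟩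
  | succ n ih =>
    have hne : S.Nonempty := card_pos.mp (by lia)
    let M := S.max' hne
    have hcard : n * (d + 1) ≤ #(S.erase M \ bad M) := by
      have := le_card_sdiff (bad M) (S.erase M)
      rw [card_erase_of_mem (S.max'_mem hne)] at this
      have := hbad M
      lia
    obtain ⟨g, hg, hgS, hgbad⟩ := ih _ hcard
    simp only [mem_sdiff, mem_erase] at hgS
    have hgM (i) : g i < M := lt_of_le_of_ne (S.le_max' _ (hgS i).1.2) (hgS i).1.1
    refine ⟨Fin.snoc (α := fun _ => α) g M, fun i j => ?_, fun i => ?_, fun i j => ?_⟩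
    · induction i using Fin.lastCases <;> induction j using Fin.lastCases <;>
        simp [hgM, hg.lt_iff_lt, (Fin.le_last _).not_gt]
    · induction i using Fin.lastCases <;> simp [hgS, M, S.max'_mem hne]
    · induction i using Fin.lastCases <;> induction j using Fin.lastCases <;>
        simp +contextual [hgS, hgbad, (Fin.le_last _).not_gt]

theorem exists_strictMono_forall_notMem_of_grid {n m K : ℕ} (hK : n * (n * m + 1) ≤ K)
    {I J : Fin n → Fin K → ℕ} (hJ : ∀ a a' b b', b < b' → J a b < J a' b')
    {E : ℕ → Finset ℕ} (hE : ∀ i, #(E i) ≤ m) :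
    ∃ g : Fin n → Fin K, StrictMono g ∧ ∀ b b', b < b' → ∀ a a', J a' (g b) ∉ E (I a (g b')) := by
  classical
  let bad (b' : Fin K) : Finset (Fin K) := {b | ∃ a', J a' b ∈ univ.biUnion fun a => E (I a b')}
  have hbad (b') : #(bad b') ≤ n * m := by
    have hunion : #(univ.biUnion fun a => E (I a b')) ≤ n * m := by
      simpa using card_biUnion_le_card_mul univ _ m fun a _ => hE (I a b')
    refine (card_le_card_of_forall_subsingleton (fun b e => ∃ a', J a' b = e) (fun b hb => ?_)
      fun e _ => ?_).trans hunion
    · obtain ⟨a', ha'⟩ := (mem_filter.mp hb).2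
      exact ⟨_, ha', a', rfl⟩
    · rintro b ⟨-, a, rfl⟩ c ⟨-, a', hc⟩
      by_contra hne
      obtain h | h := lt_or_gt_of_ne hne
      · exact (hJ a a' b c h).ne' hc
      · exact (hJ a' a c b h).ne hc
  obtain ⟨g, hg, -, hgbad⟩ := exists_strictMono_forall_notMem hbad n univ (by simpa using hK)
  refine ⟨g, hg, fun b b' hbb' a a' h => hgbad b b' hbb' ?_⟩
  simpa [bad] using ⟨a', a, h⟩

theorem exists_forall_lt_rel {ι : Type*} [LT ι] [WellFoundedLT ι] {β : ι → Type*}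
    {R : ∀ i j, β i → β j → Prop}
    (h : ∀ j (f : ∀ i : {i // i < j}, β i), ∃ v : β j, ∀ i : {i // i < j}, R i j (f i) v) :
    ∃ f : ∀ i, β i, ∀ i j, i < j → R i j (f i) (f j) := by
  choose g hg using h
  let f : ∀ i, β i := wellFounded_lt.fix fun j f => g j fun i => f i i.2
  have hf (j) : f j = g j fun i => f i := wellFounded_lt.fix_eq _ j
  exact ⟨f, fun i j hij => by rw [hf j]; exact hg j (fun i => f i) ⟨i, hij⟩⟩

end Marks

namespace OrderedGraphClass

section Marks

open Finset

variable {V : Type*} {G : SimpleGraph V} {n : ℕ}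

/-- Two vertices of `P` that are distinguished by a vertex of `Q`. -/
structure TwinPair (G : SimpleGraph V) (P Q : Set V) where
  row : V
  twin : V
  col : V
  row_mem : row ∈ P
  twin_mem : twin ∈ P
  col_mem : col ∈ Q
  adj : G.Adj row col
  not_adj : ¬ G.Adj twin col

/-- Some vertex of `Q` distinguishes two vertices of `P` that agree on `T`. -/
def Splits (G : SimpleGraph V) (P Q : Set V) (T : Finset V) : Prop :=
  ∃ s : TwinPair G P Q, ∀ z ∈ T, G.Adj s.row z ↔ G.Adj s.twin z

/-- The cell `(i, j)` is marked if, for any `t` vertices in blocks to the left of the block `j`,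
some vertex in the block `j` distinguishes two vertices of the block `i` that agree on the given
ones. The vertices are divided into blocks by `p`, in their role as rows, and by `q`, in their role
as columns; the `t` vertices have to avoid the blocks in the exceptional set `E i`. -/
def IsMark (G : SimpleGraph V) (p q : V → ℕ) (E : ℕ → Finset ℕ) (t i j : ℕ) : Prop :=
  ∀ T : Finset V, #T ≤ t → (∀ z ∈ T, q z < j ∧ q z ∉ E i) →
    Splits G (p ⁻¹' {i}) (q ⁻¹' {j}) T

theorem exists_twinPairs_of_isMark {p q : V → ℕ} {E : ℕ → Finset ℕ} {I J : Fin n → Fin n → ℕ}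
    (hJ : ∀ a a' b b', b < b' → J a b < J a' b')
    (hE : ∀ b b', b < b' → ∀ a a', J a' b ∉ E (I a b'))
    (hmark : ∀ a b, IsMark G p q E (n ^ 2) (I a b) (J a b)) :
    ∃ s : ∀ b a, TwinPair G (p ⁻¹' {I a b}) (q ⁻¹' {J a b}), ∀ b' b : Fin n, b' < b → ∀ a' a,
      G.Adj (s b a).row (s b' a').col ↔ G.Adj (s b a).twin (s b' a').col := by
  classical
  refine exists_forall_lt_rel (ι := Fin n)
    (β := fun b => ∀ a, TwinPair G (p ⁻¹' {I a b}) (q ⁻¹' {J a b}))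
    (R := fun _ _ s' s => ∀ a' a, G.Adj (s a).row (s' a').col ↔ G.Adj (s a).twin (s' a').col)
    fun b s => ?_
  let T : Finset V := univ.image fun z : {b' // b' < b} × Fin n => (s z.1 z.2).col
  have hT : #T ≤ n ^ 2 := calc
    #T ≤ Fintype.card ({b' // b' < b} × Fin n) := card_image_le
    _ = Fintype.card {b' // b' < b} * n := by simp
    _ ≤ n ^ 2 := by
      rw [sq]
      exact Nat.mul_le_mul_right n ((Fintype.card_subtype_le _).trans_eq (Fintype.card_fin n))
  have havoid (a) : ∀ z ∈ T, q z < J a b ∧ q z ∉ E (I a b) := fun z hz => by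
    obtain ⟨⟨b', a'⟩, -, rfl⟩ := mem_image.mp hz
    rw [show q (s b' a').col = J a' b' from (s b' a').col_mem]
    exact ⟨hJ _ _ _ _ b'.2, hE _ _ b'.2 _ _⟩
  choose v hv using fun a => hmark a b T hT (havoid a)
  exact ⟨v, fun b' a' a => hv a _ (mem_image_of_mem _ (mem_univ (b', a')))⟩

variable [LinearOrder V]

/-- Both alternatives for the relative position of rows and columns can be achieved by passing to
one of the two off-diagonal quarters of a grid. -/
theorem nonempty_universalGrid_of_unoriented {x : Bool → Fin (2 * n) → Fin (2 * n) → V}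
    {c : Fin (2 * n) → Fin (2 * n) → V}
    (hx : ∀ s s' a a' b b', a < a' → x s a b < x s' a' b')
    (hc : ∀ a a' b b', b < b' → c a b < c a' b')
    (hadj : ∀ a b, G.Adj (x true a b) (c a b) ∧ ¬ G.Adj (x false a b) (c a b))
    (hxc : ∀ a a' b b', b' < b → (G.Adj (x true a b) (c a' b') ↔ G.Adj (x false a b) (c a' b'))) :
    Nonempty (UniversalGrid G n) := by
  obtain ⟨lo, hi, hlo, hhi, hlohi⟩ := exists_separated n true
  have hlt (i j) : lo i < hi j := of_decide_eq_true (hlohi i j).2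
  by_cases h : ∀ s a a' b b', x s (lo a) (hi b) < c (lo a') (hi b')
  · exact ⟨{ row := fun a b => x true (lo a) (hi b)
             twin := fun a b => x false (lo a) (hi b)
             col := fun a b => c (lo a) (hi b)
             row_lt_row := fun _ _ _ _ h => hx _ _ _ _ _ _ (hlo h)
             twin_lt_twin := fun _ _ _ _ h => hx _ _ _ _ _ _ (hlo h)
             col_lt_col := fun _ _ _ _ h => hc _ _ _ _ (hhi h)
             lt_col_or_col_lt := Or.inl fun _ _ _ _ => ⟨h _ _ _ _ _, h _ _ _ _ _⟩
             adj_row_col := fun _ _ => (hadj _ _).1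
             not_adj_twin_col := fun _ _ => (hadj _ _).2
             adj_iff := fun _ _ _ _ h => hxc _ _ _ _ (hhi h) }⟩
  · push Not at h
    obtain ⟨s₀, a₀, a₀', b₀, b₀', h₀⟩ := h
    have hcx (s a a' b b') : c (hi a') (lo b') < x s (hi a) (lo b) :=
      (hc _ _ _ _ (hlt b' b₀')).trans_le h₀ |>.trans (hx _ _ _ _ _ _ (hlt a₀ a))
    exact ⟨{ row := fun a b => x true (hi a) (lo b)
             twin := fun a b => x false (hi a) (lo b)
             col := fun a b => c (hi a) (lo b)
             row_lt_row := fun _ _ _ _ h => hx _ _ _ _ _ _ (hhi h)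
             twin_lt_twin := fun _ _ _ _ h => hx _ _ _ _ _ _ (hhi h)
             col_lt_col := fun _ _ _ _ h => hc _ _ _ _ (hlo h)
             lt_col_or_col_lt := Or.inr fun _ _ _ _ => ⟨hcx _ _ _ _ _, hcx _ _ _ _ _⟩
             adj_row_col := fun _ _ => (hadj _ _).1
             not_adj_twin_col := fun _ _ => (hadj _ _).2
             adj_iff := fun _ _ _ _ h => hxc _ _ _ _ (hlo h) }⟩

theorem nonempty_universalGrid_of_isMark {p q : V → ℕ} (hp : Monotone p) (hq : Monotone q)
    {E : ℕ → Finset ℕ} {I J : Fin (2 * n) → Fin (2 * n) → ℕ}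
    (hI : ∀ a a' b b', a < a' → I a b < I a' b') (hJ : ∀ a a' b b', b < b' → J a b < J a' b')
    (hE : ∀ b b', b < b' → ∀ a a', J a' b ∉ E (I a b'))
    (hmark : ∀ a b, IsMark G p q E ((2 * n) ^ 2) (I a b) (J a b)) :
    Nonempty (UniversalGrid G n) := by
  obtain ⟨s, hs⟩ := exists_twinPairs_of_isMark hJ hE hmark
  have hp_eq (v : Bool) (a b) : p (if v then (s b a).row else (s b a).twin) = I a b := by
    cases v
    · exact (s b a).twin_mem
    · exact (s b a).row_mem
  have hq_eq (a b) : q (s b a).col = J a b := (s b a).col_mem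
  refine nonempty_universalGrid_of_unoriented
    (x := fun v a b => if v then (s b a).row else (s b a).twin) (c := fun a b => (s b a).col)
    (fun v v' a a' b b' h => hp.reflect_lt ?_) (fun a a' b b' h => hq.reflect_lt ?_)
    (fun a b => ⟨(s b a).adj, (s b a).not_adj⟩) fun a a' b b' h => hs b' b h a' a
  · rw [hp_eq, hp_eq]
    exact hI a a' b b' h
  · rw [hq_eq, hq_eq]
    exact hJ a a' b b' h

theorem exists_universalGrid_of_marks.{u} (n m : ℕ) : ∃ k : ℕ, ∀ {V : Type u} [LinearOrder V]
    {G : SimpleGraph V} {p q : V → ℕ} {S : Set (ℕ × ℕ)} {E : ℕ → Finset ℕ},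
    Monotone p → Monotone q → (∀ i, #(E i) ≤ m) →
    (∀ e ∈ S, IsMark G p q E ((2 * n) ^ 2) e.1 e.2) → HasGrid S k →
    Nonempty (UniversalGrid G n) := by
  set K := 2 * n * (2 * n * m + 1)
  refine ⟨K, fun hp hq hE hmark ⟨I, J, hS, hI, hJ⟩ => ?_⟩
  have hc := Fin.strictMono_castLE (Nat.le_mul_of_pos_right (2 * n) (2 * n * m).succ_pos)
  set ι := Fin.castLE (n := 2 * n) (m := K) _
  obtain ⟨g, hg, hgE⟩ := exists_strictMono_forall_notMem_of_grid (I := fun a b => I (ι a) b)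
    (J := fun a b => J (ι a) b) le_rfl (fun a a' b b' h => hJ _ _ _ _ h) hE
  exact nonempty_universalGrid_of_isMark hp hq (I := fun a b => I (ι a) (g b))
    (J := fun a b => J (ι a) (g b)) (fun a a' b b' h => hI _ _ _ _ (hc h))
    (fun a a' b b' h => hJ _ _ _ _ (hg h)) hgE fun a b => hmark _ (hS _ _)

end Marks

end OrderedGraphClass

/-! ### Near twins -/

section HeavyRows

open Finset

theorem exists_card_heavy_rows_le (k : ℕ) : ∃ m : ℕ, ∀ (q : ℕ) (R : ℕ → Finset ℕ),
    (∀ i, R i ⊆ range (q + 1)) → ¬ HasGrid {e | e.2 ∈ R e.1} k →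
    4 * #{i ∈ range q | m < #(R i)} ≤ q := by
  obtain ⟨c, hc⟩ := marcus_tardos k
  refine ⟨8 * c, fun q R hR hgrid => ?_⟩
  obtain rfl | hq := Nat.eq_zero_or_pos q
  · simp
  set A : Finset ℕ := {i ∈ range q | 8 * c < #(R i)}
  let S : Finset (ℕ × ℕ) := (range q ×ˢ range (q + 1)).filter fun e => e.2 ∈ R e.1
  have hS : #S ≤ c * (q + 1) := by
    refine hc (q + 1) S (fun e he => ?_) fun h => hgrid (h.mono fun e he => (mem_filter.mp he).2)
    simp only [S, mem_filter, mem_product, mem_range] at he ⊢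
    lia
  have hA : #A * (8 * c + 1) ≤ #S := by
    calc #A * (8 * c + 1) ≤ ∑ i ∈ A, #(R i) :=
          card_nsmul_le_sum A (fun i => #(R i)) _ fun i hi => (mem_filter.mp hi).2
      _ ≤ ∑ i ∈ range q, #(R i) := sum_le_sum_of_subset (filter_subset _ _)
      _ = #S := by
        simp only [S, card_filter, sum_product]
        refine sum_congr rfl fun i _ => ?_
        rw [← card_filter, filter_mem_eq_inter, inter_eq_right.mpr (hR i)]
  nlinarith

end HeavyRows

namespace OrderedGraphClass

section NearTwins

open Finset

variable {V : Type*} {G : SimpleGraph V}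

open Classical in
/-- The columns in `T` in which the row of `x` in the adjacency matrix has a one. -/
noncomputable def rowOn (G : SimpleGraph V) (T : Finset V) (x : V) : Finset V := {z ∈ T | G.Adj x z}

open Classical in
/-- The number of distinct rows of the submatrix with rows `B` and columns `T`. -/
noncomputable def numRows (G : SimpleGraph V) (B T : Finset V) : ℕ := #(B.image (rowOn G T))

theorem rowOn_eq_rowOn_iff {T : Finset V} {x y : V} :
    rowOn G T x = rowOn G T y ↔ ∀ z ∈ T, (G.Adj x z ↔ G.Adj y z) := by
  simp only [rowOn, Finset.ext_iff, mem_filter, and_congr_right_iff]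

theorem numRows_le_numRows {B T T' : Finset V}
    (h : ∀ x ∈ B, ∀ y ∈ B, rowOn G T x = rowOn G T y → rowOn G T' x = rowOn G T' y) :
    numRows G B T' ≤ numRows G B T := by
  classical
  refine card_le_card_of_forall_subsingleton
    (fun s t => ∃ x ∈ B, rowOn G T' x = s ∧ rowOn G T x = t) (fun s hs => ?_) fun t _ => ?_
  · obtain ⟨x, hx, rfl⟩ := mem_image.mp hs
    exact ⟨_, mem_image_of_mem _ hx, x, hx, rfl, rfl⟩
  · rintro _ ⟨-, x, hx, rfl, rfl⟩ _ ⟨-, y, hy, rfl, hyx⟩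
    exact h x hx y hy hyx.symm

theorem numRows_le_two_pow (B T : Finset V) : numRows G B T ≤ 2 ^ #T := by
  classical
  rw [← card_powerset]
  exact card_le_card (image_subset_iff.mpr fun x _ => mem_powerset.mpr (filter_subset _ _))

open Classical in
theorem numRows_union_le (B T T' : Finset V) :
    numRows G B (T ∪ T') ≤ numRows G B T * numRows G B T' := by
  rw [numRows, numRows, numRows, ← card_product]
  refine (card_le_card (image_subset_iff.mpr fun x hx => ?_)).trans
    (card_image_le (f := fun s : Finset V × Finset V => s.1 ∪ s.2))
  exact mem_image.mpr ⟨(rowOn G T x, rowOn G T' x),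
    mem_product.mpr ⟨mem_image_of_mem _ hx, mem_image_of_mem _ hx⟩,
      (filter_union (G.Adj x) T T').symm⟩

theorem splits_of_rowOn_ne {P Q : Set V} {T T' : Finset V} {x y : V} (hx : x ∈ P) (hy : y ∈ P)
    (hT' : (T' : Set V) ⊆ Q) (hxy : rowOn G T x = rowOn G T y) (hne : rowOn G T' x ≠ rowOn G T' y) :
    Splits G P Q T := by
  rw [rowOn_eq_rowOn_iff] at hxy
  rw [Ne, rowOn_eq_rowOn_iff] at hne
  push Not at hne
  obtain ⟨z, hz, ⟨hxz, hyz⟩ | ⟨hxz, hyz⟩⟩ := hne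
  · exact ⟨⟨x, y, z, hx, hy, hT' hz, hxz, hyz⟩, hxy⟩
  · exact ⟨⟨y, x, z, hy, hx, hT' hz, hyz, hxz⟩, fun z hz => (hxy z hz).symm⟩

variable [Fintype V] {p : V → ℕ} {r i j : ℕ}

/-- The block of the vertices that `p` maps to `i`. -/
def block (p : V → ℕ) (i : ℕ) : Finset V := {x | p x = i}

theorem mem_block {x : V} : x ∈ block p i ↔ p x = i := by simp [block]

/-- The blocks of columns having more than `r` distinct rows in the `i`-th block of rows. -/
noncomputable def richCols (G : SimpleGraph V) (p : V → ℕ) (r i : ℕ) : Finset ℕ :=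
  {j ∈ univ.image p | r < numRows G (block p i) (block p j)}

/-- The columns in blocks before the `j`-th one, outside of the rich blocks. -/
noncomputable def prefixCols (G : SimpleGraph V) (p : V → ℕ) (r i j : ℕ) : Finset V :=
  {z | p z < j ∧ p z ∉ richCols G p r i}

open Classical in
/-- The blocks of columns that are not rich and tell apart rows agreeing on the prefix. -/
noncomputable def splitCols (G : SimpleGraph V) (p : V → ℕ) (r i : ℕ) : Finset ℕ :=
  {j ∈ univ.image p | j ∉ richCols G p r i ∧
    Splits G (p ⁻¹' {i}) (p ⁻¹' {j}) (prefixCols G p r i j)}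

theorem mem_splitCols : j ∈ splitCols G p r i ↔
    j ∉ richCols G p r i ∧ Splits G (p ⁻¹' {i}) (p ⁻¹' {j}) (prefixCols G p r i j) := by
  simp only [splitCols, mem_filter, mem_image, mem_univ, true_and, and_iff_right_iff_imp]
  rintro ⟨-, s, -⟩
  exact ⟨s.col, s.col_mem⟩

theorem numRows_block_le (hr : 1 ≤ r) (hj : j ∉ richCols G p r i) :
    numRows G (block p i) (block p j) ≤ r := by
  obtain hempty | ⟨z, hz⟩ := (block p j).eq_empty_or_nonempty
  · exact (numRows_le_two_pow _ _).trans (by simpa [hempty] using hr)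
  · by_contra! h
    exact hj (mem_filter.mpr ⟨mem_image.mpr ⟨z, mem_univ z, mem_block.mp hz⟩, h⟩)

theorem prefixCols_succ_of_mem (hj : j ∈ richCols G p r i) :
    prefixCols G p r i (j + 1) = prefixCols G p r i j :=
  filter_congr fun z _ => and_congr_left fun hz => by grind

open Classical in
theorem prefixCols_succ_of_notMem (hj : j ∉ richCols G p r i) :
    prefixCols G p r i (j + 1) = prefixCols G p r i j ∪ block p j := by
  ext z
  simp only [prefixCols, mem_filter, mem_univ, true_and, mem_union, mem_block]
  grind

theorem numRows_prefixCols_succ_le (hr : 1 ≤ r) :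
    numRows G (block p i) (prefixCols G p r i (j + 1)) ≤
      numRows G (block p i) (prefixCols G p r i j) * if j ∈ splitCols G p r i then r else 1 := by
  classical
  by_cases hrich : j ∈ richCols G p r i
  · rw [prefixCols_succ_of_mem hrich]
    exact Nat.le_mul_of_pos_right _ (by split_ifs <;> omega)
  rw [prefixCols_succ_of_notMem hrich]
  split_ifs with hsplit
  · exact (numRows_union_le _ _ _).trans (Nat.mul_le_mul_left _ (numRows_block_le hr hrich))
  · rw [mul_one]
    refine numRows_le_numRows fun x hx y hy hxy => ?_
    by_contra hne
    refine hsplit (mem_splitCols.mpr ⟨hrich, splits_of_rowOn_ne (T' := block p j)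
      (mem_block.mp hx) (mem_block.mp hy) (fun z hz => mem_block.mp hz) hxy fun hb => hne ?_⟩)
    rw [rowOn_eq_rowOn_iff] at hxy hb ⊢
    exact fun z hz => (mem_union.mp hz).elim (hxy z) (hb z)

theorem numRows_prefixCols_le (hr : 1 ≤ r) (i j : ℕ) :
    numRows G (block p i) (prefixCols G p r i j) ≤ r ^ #{j' ∈ splitCols G p r i | j' < j} := by
  induction j with
  | zero => exact (numRows_le_two_pow _ _).trans (by simp [prefixCols])
  | succ j ih =>
    refine (numRows_prefixCols_succ_le hr).trans ?_
    have hsub : {j' ∈ splitCols G p r i | j' < j} ⊆ {j' ∈ splitCols G p r i | j' < j + 1} :=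
      monotone_filter_right _ fun _ _ h => Nat.lt_succ_of_lt h
    split_ifs with hsplit
    · have hinsert : insert j {j' ∈ splitCols G p r i | j' < j} ⊆
          {j' ∈ splitCols G p r i | j' < j + 1} :=
        insert_subset (mem_filter.mpr ⟨hsplit, j.lt_succ_self⟩) hsub
      calc _ ≤ r ^ #{j' ∈ splitCols G p r i | j' < j} * r := Nat.mul_le_mul_right _ ih
        _ = r ^ #(insert j {j' ∈ splitCols G p r i | j' < j}) := by
            rw [card_insert_of_notMem (by simp), pow_succ]
        _ ≤ _ := Nat.pow_le_pow_right hr (card_le_card hinsert)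
    · rw [mul_one]
      exact ih.trans (Nat.pow_le_pow_right hr (card_le_card hsub))

open Classical in
/-- The columns telling apart the rows of `x` and `y`. -/
noncomputable def diffCols (G : SimpleGraph V) (x y : V) : Finset V :=
  {z | ¬ (G.Adj x z ↔ G.Adj y z)}

theorem mem_diffCols {x y z : V} : z ∈ diffCols G x y ↔ ¬ (G.Adj x z ↔ G.Adj y z) := by
  simp [diffCols]

theorem exists_near_twins_in_block {L m₁ m₂ : ℕ} (hr : 1 ≤ r) (hi : r ^ m₂ < #(block p i))
    (hL : ∀ j, #(block p j) ≤ L) (h₁ : #(richCols G p r i) ≤ m₁) (h₂ : #(splitCols G p r i) ≤ m₂) :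
    ∃ x ∈ block p i, ∃ y ∈ block p i, x ≠ y ∧ #(diffCols G x y) ≤ m₁ * L := by
  classical
  set j := univ.sup p + 1
  have hlt : #((block p i).image (rowOn G (prefixCols G p r i j))) < #(block p i) := by
    refine lt_of_le_of_lt ?_ hi
    calc _ = numRows G (block p i) (prefixCols G p r i j) := by rw [numRows]
      _ ≤ r ^ #{j' ∈ splitCols G p r i | j' < j} := numRows_prefixCols_le hr i j
      _ ≤ r ^ m₂ := Nat.pow_le_pow_right hr ((card_filter_le _ _).trans h₂)
  obtain ⟨x, hx, y, hy, hxy, hrow⟩ := exists_ne_map_eq_of_card_lt_of_maps_to hlt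
    fun a ha => mem_image_of_mem _ ha
  rw [rowOn_eq_rowOn_iff] at hrow
  have hsub : diffCols G x y ⊆ (richCols G p r i).biUnion (block p) := fun z hz => by
    refine mem_biUnion.mpr ⟨p z, ?_, mem_block.mpr rfl⟩
    by_contra hpoor
    exact mem_diffCols.mp hz (hrow z (mem_filter.mpr
      ⟨mem_univ z, Nat.lt_succ_of_le (le_sup (mem_univ z)), hpoor⟩))
  refine ⟨x, hx, y, hy, hxy, (card_le_card hsub).trans ?_⟩
  exact (card_biUnion_le_card_mul _ _ L fun j _ => hL j).trans (Nat.mul_le_mul_right _ h₁)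

theorem isMark_of_mem_richCols {E : ℕ → Finset ℕ} {t : ℕ} (hr : 2 ^ t ≤ r)
    (hj : j ∈ richCols G p r i) : IsMark G p p E t i j := by
  intro T hT _
  by_contra hsplit
  have hle : numRows G (block p i) (block p j) ≤ numRows G (block p i) T :=
    numRows_le_numRows fun x hx y hy hxy => by
      by_contra hne
      exact hsplit (splits_of_rowOn_ne (mem_block.mp hx) (mem_block.mp hy)
        (fun z hz => mem_block.mp hz) hxy hne)
  refine (mem_filter.mp hj).2.not_ge (hle.trans ((numRows_le_two_pow _ _).trans ?_))
  exact (Nat.pow_le_pow_right two_pos hT).trans hr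

theorem isMark_of_mem_splitCols {E : ℕ → Finset ℕ} {t : ℕ} (hE : E i = richCols G p r i)
    (hj : j ∈ splitCols G p r i) : IsMark G p p E t i j := by
  intro T _ hT
  obtain ⟨s, hs⟩ := (mem_splitCols.mp hj).2
  exact ⟨s, fun z hz => hs z (mem_filter.mpr ⟨mem_univ z, hE ▸ hT z hz⟩)⟩

theorem exists_card_many_richCols_le.{u} (n : ℕ) : ∃ m : ℕ, ∀ {V : Type u} [Fintype V]
    [LinearOrder V] {G : SimpleGraph V} {p : V → ℕ} {q : ℕ}, Monotone p → (∀ x, p x ≤ q) →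
    IsEmpty (UniversalGrid G n) →
    4 * #{i ∈ range q | m < #(richCols G p (2 ^ (2 * n) ^ 2) i)} ≤ q := by
  obtain ⟨k, hk⟩ := exists_universalGrid_of_marks.{u} n 0
  obtain ⟨m, hm⟩ := exists_card_heavy_rows_le k
  refine ⟨m, fun {V} _ _ {G p q} hp hq hG => hm q _ (fun i j hj => ?_) fun hgrid => ?_⟩
  · obtain ⟨x, -, rfl⟩ := mem_image.mp (mem_filter.mp hj).1
    exact mem_range.mpr (Nat.lt_succ_of_le (hq x))
  · exact not_nonempty_iff.mpr hG (hk (E := fun _ => ∅) hp hp (fun _ => le_rfl)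
      (fun e he => isMark_of_mem_richCols le_rfl he) hgrid)

theorem exists_card_many_splitCols_le.{u} (n m₁ : ℕ) : ∃ m₂ : ℕ, ∀ {V : Type u} [Fintype V]
    [LinearOrder V] {G : SimpleGraph V} {p : V → ℕ} {q r : ℕ}, Monotone p → (∀ x, p x ≤ q) →
    IsEmpty (UniversalGrid G n) →
    4 * #{i ∈ range q | #(richCols G p r i) ≤ m₁ ∧ m₂ < #(splitCols G p r i)} ≤ q := by
  obtain ⟨k, hk⟩ := exists_universalGrid_of_marks.{u} n m₁
  obtain ⟨m₂, hm₂⟩ := exists_card_heavy_rows_le k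
  refine ⟨m₂, fun {V} _ _ {G p q r} hp hq hG => ?_⟩
  let R (C : ℕ → Finset ℕ) (i : ℕ) : Finset ℕ := if #(richCols G p r i) ≤ m₁ then C i else ∅
  have hR : ∀ i, R (splitCols G p r) i ⊆ range (q + 1) := fun i j hj => by
    obtain ⟨s, -⟩ := (mem_splitCols.mp (show j ∈ splitCols G p r i by grind)).2
    have hcol : p s.col = j := s.col_mem
    exact mem_range.mpr (Nat.lt_succ_of_le (hcol ▸ hq s.col))
  have hfilter : {i ∈ range q | m₂ < #(R (splitCols G p r) i)} =
      {i ∈ range q | #(richCols G p r i) ≤ m₁ ∧ m₂ < #(splitCols G p r i)} :=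
    filter_congr fun i _ => by grind
  rw [← hfilter]
  refine hm₂ q _ hR fun hgrid => not_nonempty_iff.mpr hG
    (hk (E := R (richCols G p r)) hp hp (fun i => ?_) (fun e he => ?_) hgrid)
  · grind
  · have hcard : #(richCols G p r e.1) ≤ m₁ := by
      by_contra h
      simp [R, h] at he
    exact isMark_of_mem_splitCols (if_pos hcard) (by simpa [R, hcard] using he)

theorem card_block_div_le {N L : ℕ} (hL : 0 < L) (i : ℕ) :
    #(block (fun x : Fin N => x / L) i) ≤ L := by
  refine (card_le_card_of_injOn (t := Ico (i * L) (i * L + L)) Fin.val (fun x hx => ?_)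
    Fin.val_injective.injOn).trans_eq (by simp)
  obtain rfl : (x : ℕ) / L = i := by simpa [mem_block] using hx
  exact mem_coe.mpr (mem_Ico.mpr ⟨Nat.div_mul_le_self x L, Nat.lt_div_mul_add hL⟩)

theorem le_card_block_div {N L i : ℕ} (hi : i < N / L) :
    L ≤ #(block (fun x : Fin N => x / L) i) := by
  have hN : (i + 1) * L ≤ N := (Nat.mul_le_mul_right L hi).trans (Nat.div_mul_le_self N L)
  rw [add_mul, one_mul] at hN
  rw [← Fintype.card_fin L, ← card_univ]
  refine card_le_card_of_injOn (fun o => ⟨i * L + o, by lia⟩) (fun o _ => ?_) fun o _ o' _ h => ?_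
  · exact mem_block.mpr (Nat.div_eq_of_lt_le (by simp) (by simp [add_mul]))
  · simpa [Fin.ext_iff] using h

theorem exists_near_twins (n : ℕ) : ∃ L D : ℕ, 0 < L ∧ ∀ {N : ℕ} {G : SimpleGraph (Fin N)},
    IsEmpty (UniversalGrid G n) → ∃ A ⊆ range (N / L), N / L ≤ 2 * #A ∧
      ∀ i ∈ A, ∃ x y : Fin N, x / L = i ∧ y / L = i ∧ x ≠ y ∧ #(diffCols G x y) ≤ D := by
  set r := 2 ^ (2 * n) ^ 2
  have hr : 1 ≤ r := Nat.one_le_two_pow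
  obtain ⟨m₁, hm₁⟩ := exists_card_many_richCols_le n
  obtain ⟨m₂, hm₂⟩ := exists_card_many_splitCols_le n m₁
  refine ⟨r ^ m₂ + 1, m₁ * (r ^ m₂ + 1), by omega, fun {N G} hG => ?_⟩
  set L := r ^ m₂ + 1
  set p : Fin N → ℕ := fun x => x / L
  have hp : Monotone p := fun x y h => Nat.div_le_div_right h
  have hpN (x) : p x ≤ N / L := Nat.div_le_div_right x.2.le
  set B₁ : Finset ℕ := {i ∈ range (N / L) | m₁ < #(richCols G p r i)}
  set B₂ : Finset ℕ :=
    {i ∈ range (N / L) | #(richCols G p r i) ≤ m₁ ∧ m₂ < #(splitCols G p r i)}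
  refine ⟨range (N / L) \ (B₁ ∪ B₂), sdiff_subset, ?_, fun i hi => ?_⟩
  · have h₁ : 4 * #B₁ ≤ N / L := hm₁ hp hpN hG
    have h₂ : 4 * #B₂ ≤ N / L := hm₂ hp hpN hG
    have := le_card_sdiff (B₁ ∪ B₂) (range (N / L))
    have := card_union_le B₁ B₂
    rw [card_range] at *
    omega
  · obtain ⟨hiN, hpoor, hunsplit⟩ : i < N / L ∧ #(richCols G p r i) ≤ m₁ ∧
        #(splitCols G p r i) ≤ m₂ := by
      simp only [B₁, B₂, mem_sdiff, mem_union, mem_filter, mem_range] at hi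
      lia
    obtain ⟨x, hx, y, hy, hxy, hD⟩ := exists_near_twins_in_block hr
      (le_card_block_div hiN) (card_block_div_le (by omega)) hpoor hunsplit
    exact ⟨x, y, mem_block (p := p).mp hx, mem_block (p := p).mp hy, hxy, hD⟩

end NearTwins

end OrderedGraphClass

namespace OrderedGraphClass

/-! ### Counting graphs without universal grids -/

open Finset

section Codes

variable {N L : ℕ} {G H : SimpleGraph (Fin N)} {X Y : Finset (Fin N)} {T : Finset (ℕ × ℕ)}

/-- A description of the part of the graph `G` involving the vertices in `Y`: such a vertex has a
partner outside `Y` in the same block of length `L`, and the positions in `T` record where the rows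
of the two differ. The set `X` tells which vertices are partners. -/
structure IsCode (G : SimpleGraph (Fin N)) (L : ℕ) (X Y : Finset (Fin N)) (T : Finset (ℕ × ℕ)) :
    Prop where
  exists_partner : ∀ y ∈ Y, ∃ x ∈ X, x ∉ Y ∧ (x : ℕ) / L = y / L
  adj_iff : ∀ x ∈ X, ∀ y ∈ Y, (x : ℕ) / L = y / L →
    ∀ v : Fin N, G.Adj y v ↔ (G.Adj x v ↔ ((y : ℕ) / L, (v : ℕ)) ∉ T)

theorem IsCode.eq (hG : IsCode G L X Y T) (hH : IsCode H L X Y T)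
    (h : ∀ u ∉ Y, ∀ v ∉ Y, G.Adj u v ↔ H.Adj u v) : G = H := by
  have hextend (v) (hv : ∀ u ∉ Y, G.Adj u v ↔ H.Adj u v) (u) : G.Adj u v ↔ H.Adj u v := by
    by_cases hu : u ∈ Y
    · obtain ⟨x, hx, hxY, hxu⟩ := hG.exists_partner u hu
      rw [hG.adj_iff x hx u hu hxu, hH.adj_iff x hx u hu hxu, hv x hxY]
    · exact hv u hu
  ext u v
  refine hextend v (fun u hu => ?_) u
  rw [G.adj_comm, H.adj_comm]
  exact hextend u (fun w hw => h w hw u hu) v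

/-- The positions `(i, z)` such that the rows of `x i` and `y i` differ in column `z`. -/
noncomputable def diffPositions (G : SimpleGraph (Fin N)) (A : Finset ℕ) (x y : ℕ → Fin N) :
    Finset (ℕ × ℕ) :=
  A.biUnion fun i => {i} ×ˢ (diffCols G (x i) (y i)).image Fin.val

variable {A : Finset ℕ} {x y : ℕ → Fin N}

theorem mem_diffPositions {e : ℕ × ℕ} : e ∈ diffPositions G A x y ↔
    e.1 ∈ A ∧ ∃ z : Fin N, ¬ (G.Adj (x e.1) z ↔ G.Adj (y e.1) z) ∧ (z : ℕ) = e.2 := by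
  simp only [diffPositions, mem_biUnion, mem_product, mem_singleton, mem_image, mem_diffCols]
  grind

theorem isMark_of_mem_diffPositions {E : ℕ → Finset ℕ} {t : ℕ} {e : ℕ × ℕ}
    (he : e ∈ diffPositions G A x y) (hx : x e.1 / L = e.1) (hy : y e.1 / L = e.1)
    (hE : E e.1 = (diffCols G (x e.1) (y e.1)).image Fin.val) :
    IsMark G (fun x => x / L) Fin.val E t e.1 e.2 := by
  intro T _ hT
  obtain ⟨-, c, hc, hce⟩ := mem_diffPositions.mp he
  have hagree : ∀ z ∈ T, G.Adj (x e.1) z ↔ G.Adj (y e.1) z := fun z hz => by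
    have hzE := (hT z hz).2
    rw [hE] at hzE
    by_contra hne
    exact hzE (mem_image_of_mem _ (mem_diffCols.mpr hne))
  by_cases hadj : G.Adj (x e.1) c
  · exact ⟨⟨x e.1, y e.1, c, hx, hy, hce, hadj, fun h => hc (iff_of_true hadj h)⟩, hagree⟩
  · refine ⟨⟨y e.1, x e.1, c, hy, hx, hce, ?_, hadj⟩, fun z hz => (hagree z hz).symm⟩
    by_contra h
    exact hc (iff_of_false hadj h)

theorem exists_diffPositions_mem_gridFree (n D : ℕ) : ∃ k : ℕ, ∀ {N L : ℕ}
    {G : SimpleGraph (Fin N)} {A : Finset ℕ} {x y : ℕ → Fin N}, IsEmpty (UniversalGrid G n) →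
    A ⊆ range N → (∀ i ∈ A, (x i : ℕ) / L = i ∧ (y i : ℕ) / L = i ∧ #(diffCols G (x i) (y i)) ≤ D) →
    diffPositions G A x y ∈ gridFree k N := by
  obtain ⟨k, hk⟩ := exists_universalGrid_of_marks n D
  refine ⟨k, fun {N L G A x y} hG hA hxy => mem_gridFree.mpr ⟨fun e he => ?_, fun hgrid => ?_⟩⟩
  · obtain ⟨heA, z, -, hz⟩ := mem_diffPositions.mp he
    exact mem_product.mpr ⟨hA heA, mem_range.mpr (hz ▸ z.2)⟩
  · let E (i : ℕ) : Finset ℕ := if i ∈ A then (diffCols G (x i) (y i)).image Fin.val else ∅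
    refine not_nonempty_iff.mpr hG (hk (p := fun x => x / L) (q := Fin.val) (E := E)
      (fun x y h => Nat.div_le_div_right h) Fin.val_strictMono.monotone (fun i => ?_)
      (fun e he => ?_) hgrid)
    · by_cases hi : i ∈ A
      · simpa only [E, if_pos hi] using card_image_le.trans (hxy i hi).2.2
      · simp [E, hi]
    · have heA := (mem_diffPositions.mp he).1
      exact isMark_of_mem_diffPositions he (hxy _ heA).1 (hxy _ heA).2.1 (if_pos heA)

theorem isCode_diffPositions
    (hxy : ∀ i ∈ A, (x i : ℕ) / L = i ∧ (y i : ℕ) / L = i ∧ x i ≠ y i) :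
    IsCode G L (A.image x) (A.image y) (diffPositions G A x y) where
  exists_partner u hu := by
    obtain ⟨i, hi, rfl⟩ := mem_image.mp hu
    obtain ⟨hxi, hyi, hne⟩ := hxy i hi
    refine ⟨x i, mem_image_of_mem x hi, fun hmem => ?_, hxi.trans hyi.symm⟩
    obtain ⟨j, hj, hji⟩ := mem_image.mp hmem
    obtain rfl : j = i := by rw [← (hxy j hj).2.1, hji, hxi]
    exact hne hji.symm
  adj_iff u hu w hw huw v := by
    obtain ⟨i, hi, rfl⟩ := mem_image.mp hu
    obtain ⟨j, hj, rfl⟩ := mem_image.mp hw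
    obtain rfl : i = j := by rw [← (hxy i hi).1, huw, (hxy j hj).2.1]
    have hmem : (i, (v : ℕ)) ∈ diffPositions G A x y ↔ ¬ (G.Adj (x i) v ↔ G.Adj (y i) v) := by
      simp [mem_diffPositions, hi, Fin.val_inj]
    rw [(hxy i hi).2.1, hmem]
    tauto

theorem exists_isCode (n : ℕ) : ∃ L k : ℕ, 0 < L ∧ ∀ {N d : ℕ} [NeZero N]
    {G : SimpleGraph (Fin N)}, IsEmpty (UniversalGrid G n) → 2 * d ≤ N / L + 1 →
    ∃ (X Y : Finset (Fin N)) (T : Finset (ℕ × ℕ)),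
      #Y = d ∧ T ∈ gridFree k N ∧ IsCode G L X Y T := by
  obtain ⟨L, D, hL, htwins⟩ := exists_near_twins n
  obtain ⟨k, hk⟩ := exists_diffPositions_mem_gridFree n D
  refine ⟨L, k, hL, fun {N d} _ G hG hd => ?_⟩
  obtain ⟨A₀, hA₀, hcard, hA₀xy⟩ := htwins hG
  obtain ⟨A, hA, rfl⟩ := exists_subset_card_eq (show d ≤ #A₀ by omega)
  choose! x y hx hy hne hD using fun i hi => hA₀xy i (hA hi)
  have hAN : A ⊆ range N := hA.trans (hA₀.trans (range_subset_range.mpr (Nat.div_le_self N L)))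
  refine ⟨A.image x, A.image y, diffPositions G A x y, card_image_of_injOn fun i hi j hj hij => ?_,
    hk hG hAN fun i hi => ⟨hx i hi, hy i hi, hD i hi⟩,
    isCode_diffPositions fun i hi => ⟨hx i hi, hy i hi, hne i hi⟩⟩
  rw [← hy i hi, ← hy j hj, hij]

theorem ncard_isCode_le {C : OrderedGraphClass} (hC : C.IsHereditary) {d : ℕ} (hY : #Y = d) :
    {G ∈ C N | IsCode G L X Y T}.ncard ≤ C.growth (N - d) := by
  have hcard : #Yᶜ = N - d := by rw [card_compl, Fintype.card_fin, hY]
  let e : Fin (N - d) ↪o Fin N := Yᶜ.orderEmbOfFin hcard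
  refine Set.ncard_le_ncard_of_injOn (fun G => G.comap e) (fun G hG => hC e G hG.1) ?_
    (Set.toFinite _)
  intro G hG H hH hGH
  refine hG.2.eq hH.2 fun u hu v hv => ?_
  have hrange : ∀ u ∉ Y, ∃ i, e i = u := fun u hu => by
    simpa [e] using (range_orderEmbOfFin Yᶜ _).superset (mem_coe.mpr (mem_compl.mpr hu))
  obtain ⟨i, rfl⟩ := hrange u hu
  obtain ⟨j, rfl⟩ := hrange v hv
  exact (congrFun₂ (congrArg SimpleGraph.Adj hGH) i j).to_iff

theorem growth_le_of_isCode {C : OrderedGraphClass} (hC : C.IsHereditary) {k d : ℕ}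
    (h : ∀ G ∈ C N, ∃ (X Y : Finset (Fin N)) (T : Finset (ℕ × ℕ)),
      #Y = d ∧ T ∈ gridFree k N ∧ IsCode G L X Y T) :
    C.growth N ≤ 2 ^ (2 * N) * #(gridFree k N) * C.growth (N - d) := by
  let W := ((univ : Finset (Finset (Fin N))) ×ˢ
    powersetCard d (univ : Finset (Fin N))) ×ˢ gridFree k N
  have hW : #W ≤ 2 ^ (2 * N) * #(gridFree k N) := by
    simp only [W, card_product, card_powersetCard, card_univ, Fintype.card_finset,
      Fintype.card_fin, two_mul, pow_add]
    gcongr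
    exact Nat.choose_le_two_pow N d
  calc C.growth N ≤ (⋃ w ∈ W, {G ∈ C N | IsCode G L w.1.1 w.1.2 w.2}).ncard := by
        refine Set.ncard_le_ncard (fun G hG => ?_) (Set.toFinite _)
        obtain ⟨X, Y, T, hY, hT, hcode⟩ := h G hG
        exact Set.mem_biUnion (x := ((X, Y), T)) (by simp [W, hY, hT]) ⟨hG, hcode⟩
    _ ≤ ∑ w ∈ W, {G ∈ C N | IsCode G L w.1.1 w.1.2 w.2}.ncard := set_ncard_biUnion_le _ _
    _ ≤ ∑ _w ∈ W, C.growth (N - d) := sum_le_sum fun _ hw => ncard_isCode_le hC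
        (mem_powersetCard.mp (mem_product.mp (mem_product.mp hw).1).2).2
    _ ≤ 2 ^ (2 * N) * #(gridFree k N) * C.growth (N - d) := by
        rw [sum_const, smul_eq_mul]
        exact Nat.mul_le_mul_right _ hW

theorem ncard_simpleGraph_le (S : Set (SimpleGraph (Fin N))) : S.ncard ≤ 2 ^ (N * N) := by
  classical
  have hinj : Function.Injective fun G : SimpleGraph (Fin N) =>
      ({e | G.Adj e.1 e.2} : Finset (Fin N × Fin N)) := fun G H h => by
    ext u v
    simpa using Finset.ext_iff.mp h (u, v)
  calc S.ncard ≤ Nat.card (SimpleGraph (Fin N)) := Set.ncard_le_card S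
    _ ≤ Nat.card (Finset (Fin N × Fin N)) := Nat.card_le_card_of_injective _ hinj
    _ = 2 ^ (N * N) := by simp

end Codes

theorem hasExpGrowth_of_isEmpty_universalGrid {C : OrderedGraphClass} (hC : C.IsHereditary) {n : ℕ}
    (h : ∀ N, ∀ G ∈ C N, IsEmpty (UniversalGrid G n)) : C.HasExpGrowth := by
  obtain ⟨L, k, hL, hcode⟩ := exists_isCode n
  obtain ⟨c, hc⟩ := card_gridFree_le k
  set K := 4 * L * (c + 2) + L with hK
  refine ⟨K, Filter.Eventually.of_forall fun N => ?_⟩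
  induction N using Nat.strong_induction_on with
  | _ N ih =>
    obtain hN | hN := lt_or_ge N L
    · refine (ncard_simpleGraph_le _).trans (Nat.pow_le_pow_right two_pos ?_)
      exact Nat.mul_le_mul_right _ (by omega)
    have : NeZero N := ⟨by omega⟩
    have hq : 1 ≤ N / L := (Nat.one_le_div_iff hL).mpr hN
    have hqN : N / L ≤ N := Nat.div_le_self N L
    have hNq : N < L * (N / L) + L := Nat.lt_mul_div_succ N hL
    set d := (N / L + 1) / 2
    have hdN : N ≤ 4 * L * d := by
      have hqd : N / L ≤ 2 * d := by omega
      nlinarith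
    have hexp : 2 * N + c * N + K * (N - d) ≤ K * N := by
      have hsplit : K * (N - d) + K * d = K * N := by rw [← mul_add, Nat.sub_add_cancel (by omega)]
      have hKd : (c + 2) * N ≤ K * d := by
        rw [hK]
        nlinarith [Nat.mul_le_mul_left (c + 2) hdN]
      linarith
    calc C.growth N ≤ 2 ^ (2 * N) * #(gridFree k N) * C.growth (N - d) :=
          growth_le_of_isCode hC fun G hG => hcode (h N G hG) (by omega)
      _ ≤ 2 ^ (2 * N) * 2 ^ (c * N) * 2 ^ (K * (N - d)) := by
          gcongr
          · exact hc N
          · exact ih _ (by omega)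
      _ = 2 ^ (2 * N + c * N + K * (N - d)) := by rw [pow_add, pow_add]
      _ ≤ 2 ^ (K * N) := Nat.pow_le_pow_right two_pos hexp

theorem exists_unavoidableClass_le_of_not_hasExpGrowth {C : OrderedGraphClass}
    (hC : C.IsHereditary) (h : ¬ C.HasExpGrowth) : ∃ c, unavoidableClass c ≤ C := by
  refine exists_unavoidableClass_le hC fun n => ?_
  by_contra! hempty
  exact h (hasExpGrowth_of_isEmpty_universalGrid hC hempty)

end OrderedGraphClass

namespace OrderedGraphClass

/-! ### The unavoidable classes have growth `2 ^ ω(n)` -/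

section Growth

variable {C : OrderedGraphClass} {m n : ℕ}

theorem HasSuperexpGrowth.not_hasExpGrowth (h : C.HasSuperexpGrowth) : ¬ C.HasExpGrowth := by
  rintro ⟨K, hK⟩
  obtain ⟨n, ⟨hle, hge⟩, hn⟩ := ((hK.and (h (K + 1))).and (Filter.eventually_ge_atTop 1)).exists
  have hexp := (Nat.pow_le_pow_iff_right one_lt_two).mp (hge.trans hle)
  rw [add_mul] at hexp
  omega

theorem hasSuperexpGrowth_of_factorial_le (h : ∀ m, (m / 2).factorial ≤ C.growth m) :
    C.HasSuperexpGrowth := by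
  intro K
  have hlim := FloorSemiring.tendsto_pow_div_factorial_atTop ((2 : ℝ) ^ (3 * K))
  obtain ⟨n₀, hn₀⟩ := Filter.eventually_atTop.mp (hlim.eventually_lt_const zero_lt_one)
  refine Filter.eventually_atTop.mpr ⟨2 * n₀ + 2, fun m hm => ?_⟩
  have hfactorial : (2 ^ (3 * K)) ^ (m / 2) ≤ (m / 2).factorial := by
    have hlt := hn₀ (m / 2) (by omega)
    rw [div_lt_one (by positivity)] at hlt
    exact_mod_cast hlt.le
  calc 2 ^ (K * m) ≤ 2 ^ (3 * K * (m / 2)) := by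
        refine Nat.pow_le_pow_right two_pos ?_
        nlinarith [Nat.mul_le_mul_left K (show m ≤ 3 * (m / 2) by omega)]
    _ = (2 ^ (3 * K)) ^ (m / 2) := pow_mul ..
    _ ≤ (m / 2).factorial := hfactorial
    _ ≤ C.growth m := h m

theorem factorial_le_growth {F : Equiv.Perm (Fin n) → SimpleGraph (Fin m)}
    (hF : Function.Injective F) (hmem : ∀ σ, F σ ∈ C m) : n.factorial ≤ C.growth m :=
  calc n.factorial = (Set.range F).ncard := by
        rw [← Nat.card_coe_set_eq, Nat.card_range_of_injective hF, Nat.card_eq_fintype_card,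
          Fintype.card_perm, Fintype.card_fin]
    _ ≤ C.growth m := Set.ncard_le_ncard (Set.range_subset_iff.mpr hmem) (Set.toFinite _)

theorem permGraph_injective (n : ℕ) : Function.Injective (permGraph (n := n)) := by
  intro π π' h
  have hadj : ∀ i j, i < j → (π j < π i ↔ π' j < π' i) := fun i j hij => by
    simpa [permGraph, hij, hij.not_gt] using (congrFun₂ (congrArg SimpleGraph.Adj h) i j).to_iff
  have hlt : ∀ i j, π i < π j → π' i < π' j := fun i j hπ => by
    obtain hij | rfl | hij := lt_trichotomy i j
    · exact lt_of_le_of_ne (not_lt.mp (mt (hadj i j hij).mpr hπ.not_gt)) (π'.injective.ne hij.ne)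
    · exact absurd hπ (lt_irrefl _)
    · exact (hadj j i hij).mp hπ
  have hmono : StrictMono (π.symm.trans π') := fun x y hxy => hlt _ _ (by simpa using hxy)
  have hrefl : hmono.orderIsoOfSurjective _ (π.symm.trans π').surjective = OrderIso.refl _ :=
    Subsingleton.elim _ _
  refine Equiv.ext fun i => ?_
  simpa using (DFunLike.congr_fun hrefl (π i)).symm

theorem hasSuperexpGrowth_permClass : HasSuperexpGrowth permClass :=
  hasSuperexpGrowth_of_factorial_le fun m => (Nat.factorial_le (Nat.div_le_self m 2)).trans <|
    factorial_le_growth (permGraph_injective m) Set.mem_range_self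

theorem Pattern.cross_injective (s : Pattern) {σ τ : Equiv.Perm (Fin n)}
    (h : ∀ i j, s.cross σ i j ↔ s.cross τ i j) : σ = τ := by
  have hsymm : (∀ j, σ.symm j = τ.symm j) → σ = τ := fun h =>
    Equiv.symm_bijective.injective (Equiv.ext h)
  cases s with
  | eq => exact Equiv.ext fun i => ((h i _).mp rfl).symm
  | ne => exact Equiv.ext fun i => not_not.mp fun hne => (h i (τ i)).mp hne rfl
  | leL => exact hsymm fun j => eq_of_forall_le_iff fun i => h i j
  | geL => exact hsymm fun j => eq_of_forall_ge_iff fun i => h i j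
  | leR => exact Equiv.ext fun i => eq_of_forall_le_iff fun j => h i j
  | geR => exact Equiv.ext fun i => eq_of_forall_ge_iff fun j => h i j

theorem exists_orderEmbedding_sumLex (h : n ≤ m) (h₂ : 2 * n ≤ m) :
    ∃ (f : Fin m ↪o Fin m ⊕ₗ Fin m) (x y : Fin n → Fin m), ∀ i,
      f (x i) = toLex (.inl (Fin.castLE h i)) ∧ f (y i) = toLex (.inr (Fin.castLE h i)) := by
  let f (i : Fin m) : Fin m ⊕ₗ Fin m :=
    if (i : ℕ) < n then toLex (.inl i) else toLex (.inr ⟨i - n, by omega⟩)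
  have hf : StrictMono f := by
    intro i j hij
    have : (i : ℕ) < j := hij
    by_cases hi : (i : ℕ) < n <;> by_cases hj : (j : ℕ) < n
    · simpa [f, hi, hj] using hij
    · simp [f, hi, hj]
    · omega
    · simp only [f, hi, hj, if_false, Sum.Lex.toLex_lt_toLex, Sum.lex_inr_inr, Fin.mk_lt_mk]
      omega
  exact ⟨OrderEmbedding.ofStrictMono f hf, Fin.castLE h, fun i => ⟨n + i, by omega⟩,
    fun i => by simp [f, Fin.ext_iff]⟩

theorem hasSuperexpGrowth_matchingClass (s : Pattern) (lam rho : Bool) :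
    HasSuperexpGrowth (matchingClass s lam rho) := by
  refine hasSuperexpGrowth_of_factorial_le fun m => ?_
  have hm : m / 2 ≤ m := Nat.div_le_self m 2
  obtain ⟨f, x, y, hf⟩ := exists_orderEmbedding_sumLex hm (Nat.mul_div_le m 2)
  choose τ hτ using exists_perm_castLE hm
  refine factorial_le_growth (F := fun σ => (matchingGraph s lam rho (τ σ)).comap f)
    (fun σ σ' h => s.cross_injective fun i j => ?_) fun σ => ⟨m, τ σ, f, rfl⟩
  have hadj := (congrFun₂ (congrArg SimpleGraph.Adj h) (x i) (y j)).to_iff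
  simp only [SimpleGraph.comap_adj, hf] at hadj
  rw [← Pattern.cross_castLE hm (hτ σ), ← Pattern.cross_castLE hm (hτ σ')]
  exact hadj

theorem hasSuperexpGrowth_unavoidableClass : ∀ c, HasSuperexpGrowth (unavoidableClass c)
  | none => hasSuperexpGrowth_permClass
  | some (s, lam, rho) => hasSuperexpGrowth_matchingClass s lam rho

end Growth

/-! ### The unavoidable classes are pairwise incomparable -/

/-- The `2 × 2` submatrices that do not occur in the given pattern; `a`, `b`, `c` are the entries
in the upper left, the lower left, and the upper right corner. -/
def Pattern.Forbidden (s : Pattern) (a b c : Prop) : Prop :=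
  match s with
  | .eq => a ∧ b
  | .ne => ¬ a ∧ ¬ b
  | .leL => ¬ a ∧ b
  | .geL => a ∧ ¬ b
  | .leR => ¬ a ∧ c
  | .geR => a ∧ ¬ c

instance (s : Pattern) (a b c : Prop) [Decidable a] [Decidable b] [Decidable c] :
    Decidable (s.Forbidden a b c) := by
  cases s <;> unfold Pattern.Forbidden <;> infer_instance

instance {n : ℕ} (s : Pattern) (σ : Equiv.Perm (Fin n)) (i j : Fin n) :
    Decidable (s.cross σ i j) := by
  cases s <;> unfold Pattern.cross <;> infer_instance

theorem Pattern.not_forbidden_cross {n : ℕ} (s : Pattern) (σ : Equiv.Perm (Fin n))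
    {i i' j j' : Fin n} (hi : i < i') (hj : j < j') :
    ¬ s.Forbidden (s.cross σ i j) (s.cross σ i' j) (s.cross σ i j') := by
  cases s with
  | eq => exact fun h => hi.ne (σ.injective (h.1.trans h.2.symm))
  | ne => exact fun h => hi.ne (σ.injective ((not_not.mp h.1).trans (not_not.mp h.2).symm))
  | leL => exact fun h => h.1 (hi.le.trans h.2)
  | geL => exact fun h => h.2 (h.1.trans hi.le)
  | leR => exact fun h => h.1 (hj.le.trans h.2)
  | geR => exact fun h => h.2 (h.1.trans hj.le)

/-- A permutation whose matching graphs distinguish the unavoidable classes: for each pattern, row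
`3` and column `1` of the cross matrix are not constant, and the part of the matrix above and to the
right of them contains all the submatrices forbidden in the other patterns. -/
def testPerm : Equiv.Perm (Fin 5) := Equiv.swap 1 2

theorem testPerm_row (s : Pattern) : ∃ j j', s.cross testPerm 3 j ∧ ¬ s.cross testPerm 3 j' := by
  revert s; decide

theorem testPerm_col (s : Pattern) : ∃ i i', s.cross testPerm i 1 ∧ ¬ s.cross testPerm i' 1 := by
  revert s; decide

theorem testPerm_forbidden {s t : Pattern} (h : s ≠ t) : ∃ i i' j j' : Fin 5,
    i < i' ∧ i' ≤ 3 ∧ 1 ≤ j ∧ j < j' ∧ t.Forbidden (s.cross testPerm i j)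
      (s.cross testPerm i' j) (s.cross testPerm i j') := by
  revert s t; decide

theorem testPerm_not_transitive (s : Pattern) (lam rho : Bool) :
    (∃ i i' j, i < i' ∧ (s.cross testPerm i' j ↔ lam = true) ∧
      ¬ (s.cross testPerm i j ↔ lam = true)) ∨
    ∃ i j j', j < j' ∧ (s.cross testPerm i j ↔ rho = true) ∧
      ¬ (s.cross testPerm i j' ↔ rho = true) := by
  revert s lam rho; decide

section Incomparable

variable {V : Type*} [Preorder V] {G : SimpleGraph V} {n : ℕ} {s s' : Pattern}
  {lam rho lam' rho' : Bool} {σ : Equiv.Perm (Fin n)} {left : Set V}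

theorem exists_isInducedOrdered_of_matchingClass_le {C : OrderedGraphClass}
    (h : matchingClass s lam rho ≤ C) (σ : Equiv.Perm (Fin n)) :
    ∃ m, ∃ H ∈ C m, IsInducedOrdered (matchingGraph s lam rho σ) H := by
  let e := Fintype.orderIsoFinOfCardEq (Fin n ⊕ₗ Fin n) rfl
  refine ⟨_, _, h _ ⟨n, σ, e.toOrderEmbedding, rfl⟩, e.symm.toOrderEmbedding, ?_⟩
  ext x y
  change _ ↔ (matchingGraph s lam rho σ).Adj (e (e.symm x)) (e (e.symm y))
  rw [e.apply_symm_apply, e.apply_symm_apply]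

theorem IsInducedOrdered.adj_trans {π : Equiv.Perm (Fin n)} (h : IsInducedOrdered G (permGraph π))
    {x y z : V} (hxy : x < y) (hyz : y < z) {b : Bool} (hadj_xy : G.Adj x y ↔ b = true)
    (hadj_yz : G.Adj y z ↔ b = true) : G.Adj x z ↔ b = true := by
  obtain ⟨f, rfl⟩ := h
  have hadj {u v : V} (huv : u < v) : ((permGraph π).comap f).Adj u v ↔ π (f v) < π (f u) := by
    have hf := f.strictMono huv
    simp [permGraph, hf, hf.not_gt]
  rw [hadj hxy] at hadj_xy
  rw [hadj hyz] at hadj_yz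
  rw [hadj (hxy.trans hyz)]
  cases b <;> simp only [Bool.false_eq_true, iff_false, iff_true, not_lt] at *
  · exact hadj_xy.trans hadj_yz
  · exact hadj_yz.trans hadj_xy

theorem not_matchingClass_le_permClass (s : Pattern) (lam rho : Bool) :
    ¬ matchingClass s lam rho ≤ permClass := by
  intro hle
  obtain ⟨m, _, ⟨π, rfl⟩, h⟩ := exists_isInducedOrdered_of_matchingClass_le hle testPerm
  obtain ⟨i, i', j, hi, hi'j, hij⟩ | ⟨i, j, j', hj, hij, hij'⟩ := testPerm_not_transitive s lam rho
  · exact hij (h.adj_trans (x := toLex (.inl i)) (y := toLex (.inl i')) (z := toLex (.inr j))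
      (by simpa using hi) (Sum.Lex.inl_lt_inr _ _) (and_iff_right hi.ne) hi'j)
  · exact hij' (h.adj_trans (x := toLex (.inl i)) (y := toLex (.inr j)) (z := toLex (.inr j'))
      (Sum.Lex.inl_lt_inr _ _) (by simpa using hj) hij (and_iff_right hj.ne))

/-- The division of an induced ordered subgraph of `matchingGraph s lam rho σ` into left and right
vertices, as far as it does not depend on `σ`. -/
structure IsDivision (s : Pattern) (lam rho : Bool) (G : SimpleGraph V) (left : Set V) : Prop where
  isLowerSet : IsLowerSet left
  adj_left : ∀ {u v}, u < v → v ∈ left → (G.Adj u v ↔ lam = true)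
  adj_right : ∀ {u v}, u < v → u ∉ left → (G.Adj u v ↔ rho = true)
  not_forbidden : ∀ {u u' v v'}, u < u' → u' ∈ left → v ∉ left → v < v' →
    ¬ s.Forbidden (G.Adj u v) (G.Adj u' v) (G.Adj u v')

theorem IsDivision.comap {W : Type*} [Preorder W] (h : IsDivision s lam rho G left) (f : W ↪o V) :
    IsDivision s lam rho (G.comap f) (f ⁻¹' left) where
  isLowerSet := h.isLowerSet.preimage f.monotone
  adj_left huv := h.adj_left (f.strictMono huv)
  adj_right huv := h.adj_right (f.strictMono huv)
  not_forbidden hu hu' hv hvv' := h.not_forbidden (f.strictMono hu) hu' hv (f.strictMono hvv')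

theorem isLowerSet_range_inl {α β : Type*} [Preorder α] [Preorder β] :
    IsLowerSet (Set.range (toLex ∘ Sum.inl : α → α ⊕ₗ β)) := by
  rintro _ v hv ⟨i, rfl⟩
  induction v using Lex.rec with | _ v
  rcases v with j | j
  · exact ⟨j, rfl⟩
  · simp at hv

theorem exists_eq_inr_of_notMem_range_inl {α β : Type*} {v : α ⊕ₗ β}
    (hv : v ∉ Set.range (toLex ∘ Sum.inl : α → α ⊕ₗ β)) : ∃ j, toLex (.inr j) = v := by
  induction v using Lex.rec with | _ v
  rcases v with i | j
  · exact absurd ⟨i, rfl⟩ hv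
  · exact ⟨j, rfl⟩

theorem isDivision_matchingGraph (s : Pattern) (lam rho : Bool) (σ : Equiv.Perm (Fin n)) :
    IsDivision s lam rho (matchingGraph s lam rho σ) (Set.range (toLex ∘ Sum.inl)) where
  isLowerSet := isLowerSet_range_inl
  adj_left huv hv := by
    obtain ⟨i, rfl⟩ := isLowerSet_range_inl huv.le hv
    obtain ⟨j, rfl⟩ := hv
    exact and_iff_right (by simpa using huv.ne)
  adj_right huv hu := by
    obtain ⟨j, rfl⟩ := exists_eq_inr_of_notMem_range_inl fun hv =>
      hu (isLowerSet_range_inl huv.le hv)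
    obtain ⟨i, rfl⟩ := exists_eq_inr_of_notMem_range_inl hu
    exact and_iff_right (by simpa using huv.ne)
  not_forbidden huu' hu' hv hvv' := by
    obtain ⟨i, rfl⟩ := isLowerSet_range_inl huu'.le hu'
    obtain ⟨i', rfl⟩ := hu'
    obtain ⟨j', rfl⟩ := exists_eq_inr_of_notMem_range_inl fun hv' =>
      hv (isLowerSet_range_inl hvv'.le hv')
    obtain ⟨j, rfl⟩ := exists_eq_inr_of_notMem_range_inl hv
    exact s.not_forbidden_cross σ (by simpa using huu') (by simpa using hvv')

theorem exists_isDivision {m : ℕ} {H : SimpleGraph (Fin m)} (hH : H ∈ matchingClass s lam rho m)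
    (h : IsInducedOrdered G H) : ∃ left, IsDivision s lam rho G left := by
  obtain ⟨n, σ, hHσ⟩ := hH
  obtain ⟨f, rfl⟩ := h.trans hHσ
  exact ⟨_, (isDivision_matchingGraph s lam rho σ).comap f⟩

theorem not_permClass_le_matchingClass (s : Pattern) (lam rho : Bool) :
    ¬ permClass ≤ matchingClass s lam rho := by
  intro hle
  let π : Equiv.Perm (Fin 6) := Equiv.swap 1 2 * Equiv.swap 4 5
  obtain ⟨left, h⟩ := exists_isDivision (hle 6 ⟨π, rfl⟩) ⟨RelEmbedding.refl _, rfl⟩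
  have hadj : ¬ (permGraph π).Adj 0 1 ∧ (permGraph π).Adj 1 2 ∧ ¬ (permGraph π).Adj 3 4 ∧
      (permGraph π).Adj 4 5 := by
    simp only [permGraph]; decide
  obtain ⟨h01, h12, h34, h45⟩ := hadj
  by_cases h2 : 2 ∈ left
  · have h1 : 1 ∈ left := h.isLowerSet (by decide) h2
    exact h01 ((h.adj_left (by decide) h1).mpr ((h.adj_left (by decide) h2).mp h12))
  · have h3 : 3 ∉ left := fun h3 => h2 (h.isLowerSet (by decide) h3)
    have h4 : 4 ∉ left := fun h4 => h3 (h.isLowerSet (by decide) h4)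
    exact h34 ((h.adj_right (by decide) h3).mpr ((h.adj_right (by decide) h4).mp h45))

theorem IsDivision.inl_mem {left : Set (Fin n ⊕ₗ Fin n)}
    (h : IsDivision s' lam' rho' (matchingGraph s lam rho σ) left) {i j j' : Fin n}
    (hj : s.cross σ i j) (hj' : ¬ s.cross σ i j') : toLex (.inl i) ∈ left := by
  by_contra hi
  exact hj' ((h.adj_right (Sum.Lex.inl_lt_inr i j') hi).mpr
    ((h.adj_right (Sum.Lex.inl_lt_inr i j) hi).mp hj))

theorem IsDivision.inr_notMem {left : Set (Fin n ⊕ₗ Fin n)}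
    (h : IsDivision s' lam' rho' (matchingGraph s lam rho σ) left) {i i' j : Fin n}
    (hi : s.cross σ i j) (hi' : ¬ s.cross σ i' j) : toLex (.inr j) ∉ left := by
  intro hj
  exact hi' ((h.adj_left (Sum.Lex.inl_lt_inr i' j) hj).mpr
    ((h.adj_left (Sum.Lex.inl_lt_inr i j) hj).mp hi))

theorem not_matchingClass_le_matchingClass (hne : (s, lam, rho) ≠ (s', lam', rho')) :
    ¬ matchingClass s lam rho ≤ matchingClass s' lam' rho' := by
  intro hle
  obtain ⟨m, H, hH, hind⟩ := exists_isInducedOrdered_of_matchingClass_le hle testPerm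
  obtain ⟨left, h⟩ := exists_isDivision hH hind
  have h3 : toLex (.inl 3) ∈ left := by
    obtain ⟨j, j', hj, hj'⟩ := testPerm_row s
    exact h.inl_mem hj hj'
  have h1 : toLex (.inr 1) ∉ left := by
    obtain ⟨i, i', hi, hi'⟩ := testPerm_col s
    exact h.inr_notMem hi hi'
  have hlam : lam = lam' := Bool.eq_iff_iff.mpr <| (and_iff_right (by decide)).symm.trans <|
    h.adj_left (u := toLex (.inl 2)) (by simp) h3
  have hrho : rho = rho' := Bool.eq_iff_iff.mpr <| (and_iff_right (by decide)).symm.trans <|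
    h.adj_right (v := toLex (.inr 2)) (by simp) h1
  have hs : s ≠ s' := by
    rintro rfl
    exact hne (by rw [hlam, hrho])
  obtain ⟨i, i', j, j', hi, hi', hj, hj', hforbidden⟩ := testPerm_forbidden hs
  refine h.not_forbidden (u := toLex (.inl i)) (u' := toLex (.inl i')) (v := toLex (.inr j))
    (v' := toLex (.inr j')) (by simpa using hi) (h.isLowerSet (by simpa using hi') h3)
    (fun hmem => h1 (h.isLowerSet (by simpa using hj) hmem)) (by simpa using hj') hforbidden

theorem not_unavoidableClass_le : ∀ {c d : Option (Pattern × Bool × Bool)}, c ≠ d →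
    ¬ unavoidableClass c ≤ unavoidableClass d
  | none, none, h => absurd rfl h
  | none, some (_, _, _), _ => not_permClass_le_matchingClass _ _ _
  | some (_, _, _), none, _ => not_matchingClass_le_permClass _ _ _
  | some (_, _, _), some (_, _, _), h =>
    not_matchingClass_le_matchingClass fun h' => h (congrArg some h')

theorem unavoidableClass_injective : Function.Injective unavoidableClass := by
  intro c d h
  by_contra hne
  exact not_unavoidableClass_le hne h.le

end Incomparable

/-! ### Classification -/

theorem isStanleyWilf_unavoidableClass (c : Option (Pattern × Bool × Bool)) :
    (unavoidableClass c).IsStanleyWilf := by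
  refine ⟨isHereditary_unavoidableClass c, hasSuperexpGrowth_unavoidableClass c,
    fun D hD hlt => ?_⟩
  by_contra hexp
  obtain ⟨d, hd⟩ := exists_unavoidableClass_le_of_not_hasExpGrowth hD hexp
  obtain rfl | hdc := eq_or_ne d c
  · exact hlt.not_ge hd
  · exact not_unavoidableClass_le hdc (hd.trans hlt.le)

theorem isStanleyWilf_iff_mem_range {C : OrderedGraphClass} :
    C.IsStanleyWilf ↔ C ∈ Set.range unavoidableClass := by
  constructor
  · rintro ⟨hC, hsuperexp, hmin⟩
    obtain ⟨c, hc⟩ := exists_unavoidableClass_le_of_not_hasExpGrowth hC hsuperexp.not_hasExpGrowth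
    refine ⟨c, hc.eq_of_not_lt fun hlt => ?_⟩
    exact (hasSuperexpGrowth_unavoidableClass c).not_hasExpGrowth
      (hmin _ (isHereditary_unavoidableClass c) hlt)
  · rintro ⟨c, rfl⟩
    exact isStanleyWilf_unavoidableClass c

theorem isStanleyWilf_iff {C : OrderedGraphClass} :
    C.IsStanleyWilf ↔ C = permClass ∨ ∃ s lam rho, C = matchingClass s lam rho := by
  simp only [isStanleyWilf_iff_mem_range, Set.mem_range, Option.exists, Prod.exists,
    unavoidableClass, eq_comm]

theorem ncard_isStanleyWilf : {C : OrderedGraphClass | C.IsStanleyWilf}.ncard = 25 := by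
  have hrange : {C : OrderedGraphClass | C.IsStanleyWilf} = Set.range unavoidableClass :=
    Set.ext fun _ => isStanleyWilf_iff_mem_range
  rw [hrange, ← Nat.card_coe_set_eq, Nat.card_range_of_injective unavoidableClass_injective,
    Nat.card_eq_fintype_card]
  rfl

end OrderedGraphClass

theorem corollary7p9 :
    (∀ C : OrderedGraphClass, C.IsStanleyWilf ↔
      (C = OrderedGraphClass.permClass ∨
        ∃ (s : OrderedGraphClass.Pattern) (lam rho : Bool),
          C = OrderedGraphClass.matchingClass s lam rho)) ∧
    {C : OrderedGraphClass | C.IsStanleyWilf}.ncard = 25 ∧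
    (∀ (s : OrderedGraphClass.Pattern) (lam rho : Bool),
      ¬ OrderedGraphClass.permClass ≤ OrderedGraphClass.matchingClass s lam rho ∧
      ¬ OrderedGraphClass.matchingClass s lam rho ≤ OrderedGraphClass.permClass) ∧
    (∀ (s s' : OrderedGraphClass.Pattern) (lam lam' rho rho' : Bool),
      (s, lam, rho) ≠ (s', lam', rho') →
        ¬ OrderedGraphClass.matchingClass s lam rho ≤
            OrderedGraphClass.matchingClass s' lam' rho') := by
  open OrderedGraphClass in
  exact ⟨fun C => isStanleyWilf_iff, ncard_isStanleyWilf,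
    fun s lam rho => ⟨not_permClass_le_matchingClass s lam rho,
      not_matchingClass_le_permClass s lam rho⟩,
    fun _ _ _ _ _ _ hne => not_matchingClass_le_matchingClass hne⟩
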